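/- A PROP is a symmetric strict monoidal category with object set $\mathbb{N}$ and monoidal product $+$ on objects; PROP morphisms are identity-on-objects strict symmetric monoidal functors, and $\mathsf{P}$ is the PROP of permutations (the initial PROP). Composition is written in diagrammatic order. A symmetric monoidal theory (SMT) $(\Sigma,E)$ consists of a signature $\Sigma$ of generators $n\to m$ and a set $E$ of equations between $\Sigma$-terms of equal type; a PROP is presented by $(\Sigma,E)$ if it is isomorphic to the PROP of $\Sigma$-terms modulo $E$ and the laws of symmetric strict monoidal categories. For PROPs $\mathcal A,\mathcal B$, let $\mathcal A\otimes_{\mathsf P}\mathcal B$ be the set of composable pairs $[f\in\mathcal A,\,g\in\mathcal B]$ modulo $[f;p,\,g]=[f,\,p;g]$ for permutations $p$; similarly for triples. A distributive law $\lambda:\mathcal B\otimes_{\mathsf P}\mathcal A\to\mathcal A\otimes_{\mathsf P}\mathcal B$ is a map preserving source, target, the monoidal product with its unit, and the left and right actions of permutations, and compatible with the identities and compositions of $\mathcal A$ and $\mathcal B$ in the sense of Beck. It makes $\mathcal A\otimes_{\mathsf P}\mathcal B$ a PROP, in which $[f,g];[f',g']=[f;f'',\,g'';g']$ where $\lambda[g,f']=[f'',g'']$.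 If $\mathcal A$ and $\mathcal B$ are presented by SMTs, $E_\lambda$ is the set of all equations $g;f=f';g'$ between terms such that $\lambda[g,f]=[f',g']$. **Proposition.** Let $\mathcal F,\mathcal G,\mathcal H$ be PROPs presented by SMTs $(\Sigma_{\mathcal F},E_{\mathcal F})$, $(\Sigma_{\mathcal G},E_{\mathcal G})$, $(\Sigma_{\mathcal H},E_{\mathcal H})$, and let $$\lambda:\mathcal H\otimes_{\mathsf P}\mathcal F\to\mathcal F\otimes_{\mathsf P}\mathcal H,\qquad \chi:\mathcal H\otimes_{\mathsf P}\mathcal G\to\mathcal G\otimes_{\mathsf P}\mathcal H,\qquad \psi:\mathcal G\otimes_{\mathsf P}\mathcal F\to\mathcal F\otimes_{\mathsf P}\mathcal G$$ be distributive laws satisfying the Yang–Baxter equation: as maps $\mathcal H\otimes_{\mathsf P}\mathcal G\otimes_{\mathsf P}\mathcal F\to\mathcal F\otimes_{\mathsf P}\mathcal G\otimes_{\mathsf P}\mathcal H$, the composite of $\mathcal H\psi$, $\lambda\mathcal G$, $\mathcal F\chi$ (in this order) equals the composite of $\chi\mathcal F$, $\mathcal G\lambda$, $\psi\mathcal H$.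 Then the composed PROP $\mathcal F\otimes_{\mathsf P}\mathcal G\otimes_{\mathsf P}\mathcal H$ exists. That is, the composite $\alpha$ of $\lambda\mathcal G$ and $\mathcal F\chi$ is a distributive law of $\mathcal H$ over $\mathcal F\otimes_{\mathsf P}\mathcal G$, the composite $\beta$ of $\mathcal G\lambda$ and $\psi\mathcal H$ is a distributive law of $\mathcal G\otimes_{\mathsf P}\mathcal H$ over $\mathcal F$, and the PROPs $(\mathcal F\otimes_{\mathsf P}\mathcal G)\otimes_{\mathsf P}\mathcal H$ and $\mathcal F\otimes_{\mathsf P}(\mathcal G\otimes_{\mathsf P}\mathcal H)$ that they determine are isomorphic by rebracketing $[[f,g],h]\mapsto[f,[g,h]]$. Moreover this PROP is presented by the SMT with signature $\Sigma_{\mathcal F}\uplus\Sigma_{\mathcal G}\uplus\Sigma_{\mathcal H}$ and equations $E_{\mathcal F}\cup E_{\mathcal G}\cup E_{\mathcal H}\cup E_\lambda\cup E_\chi\cup E_\psi$, by an isomorphism that sends each generator to its interpretation in $\mathcal F$, $\mathcal G$ or $\mathcal H$, included in the composite. -/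

import Mathlib

/-!
PROPs, symmetric monoidal theories, and distributive laws of PROPs.

Composites are written in diagrammatic order: `comp f g` is `f ; g`, first `f`, then `g`.
-/

/-- Transport of an arrow along equalities of its source and of its target. -/
def castHom (X : ℕ → ℕ → Type*) {a a' b b' : ℕ} (ha : a = a') (hb : b = b') (f : X a b) :
    X a' b' :=
  ha ▸ hb ▸ f

theorem castHom_map {X Y : ℕ → ℕ → Type*} (φ : ∀ {n m}, X n m → Y n m) {a a' b b' : ℕ}
    (ha : a = a') (hb : b = b') (f : X a b) :
    φ (castHom X ha hb f) = castHom Y ha hb (φ f) := by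
  subst ha hb; rfl

/-- A PROP: a symmetric strict monoidal category whose objects are the natural numbers, with
monoidal product on objects given by addition. -/
structure PROP where
  Hom : ℕ → ℕ → Type*
  id : ∀ n, Hom n n
  comp : ∀ {a b c}, Hom a b → Hom b c → Hom a c
  tensor : ∀ {a b c d}, Hom a b → Hom c d → Hom (a + c) (b + d)
  swap : ∀ m n, Hom (m + n) (n + m)
  id_comp : ∀ {a b} (f : Hom a b), comp (id a) f = f
  comp_id : ∀ {a b} (f : Hom a b), comp f (id b) = f
  comp_assoc : ∀ {a b c d} (f : Hom a b) (g : Hom b c) (h : Hom c d),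
    comp (comp f g) h = comp f (comp g h)
  tensor_id : ∀ a b, tensor (id a) (id b) = id (a + b)
  tensor_comp : ∀ {a b c a' b' c'} (f : Hom a b) (g : Hom b c) (f' : Hom a' b') (g' : Hom b' c'),
    tensor (comp f g) (comp f' g') = comp (tensor f f') (tensor g g')
  tensor_assoc : ∀ {a b c d k l} (f : Hom a b) (g : Hom c d) (h : Hom k l),
    castHom Hom (add_assoc a c k) (add_assoc b d l) (tensor (tensor f g) h) = tensor f (tensor g h)
  zero_tensor : ∀ {a b} (f : Hom a b),
    castHom Hom (zero_add a) (zero_add b) (tensor (id 0) f) = f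
  tensor_zero : ∀ {a b} (f : Hom a b),
    castHom Hom (add_zero a) (add_zero b) (tensor f (id 0)) = f
  swap_natural : ∀ {a b c d} (f : Hom a b) (g : Hom c d),
    comp (tensor f g) (swap b d) = comp (swap a c) (tensor g f)
  swap_swap : ∀ m n, comp (swap m n) (swap n m) = id (m + n)
  swap_add : ∀ m n k, swap m (n + k) =
    comp (castHom Hom (add_assoc m n k) (add_assoc n m k) (tensor (swap m n) (id k)))
      (castHom Hom rfl (add_assoc n k m).symm (tensor (id n) (swap m k)))

/-- A morphism of PROPs: an identity-on-objects strict symmetric monoidal functor. -/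
structure PROP.Mor (A B : PROP) where
  toFun : ∀ {n m}, A.Hom n m → B.Hom n m
  map_id : ∀ n, toFun (A.id n) = B.id n
  map_comp : ∀ {a b c} (f : A.Hom a b) (g : A.Hom b c),
    toFun (A.comp f g) = B.comp (toFun f) (toFun g)
  map_tensor : ∀ {a b c d} (f : A.Hom a b) (g : A.Hom c d),
    toFun (A.tensor f g) = B.tensor (toFun f) (toFun g)
  map_swap : ∀ m n, toFun (A.swap m n) = B.swap m n

/-- An isomorphism of PROPs: a morphism that is bijective on all sets of arrows. -/
structure PROP.Iso (A B : PROP) extends PROP.Mor A B where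
  bijective : ∀ n m, Function.Bijective (toFun : A.Hom n m → B.Hom n m)

/-! ### Symmetric monoidal theories and the PROPs they generate -/

/-- A signature: for all `n` and `m`, the set of generators with arity `n` and coarity `m`. -/
def Signature := ℕ → ℕ → Type*

/-- The disjoint union of two signatures. -/
def Signature.sum (S T : Signature) : Signature := fun n m => S n m ⊕ T n m

/-- `S`-terms of type `n → m`. -/
inductive Signature.Term (S : Signature) : ℕ → ℕ → Type _ where
  | gen {n m : ℕ} : S n m → Signature.Term S n m
  | id (n : ℕ) : Signature.Term S n n
  | swap (m n : ℕ) : Signature.Term S (m + n) (n + m)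
  | comp {a b c : ℕ} : Signature.Term S a b → Signature.Term S b c → Signature.Term S a c
  | tensor {a b c d : ℕ} : Signature.Term S a b → Signature.Term S c d →
      Signature.Term S (a + c) (b + d)

/-- Renaming of the generators of a term. -/
def Signature.Term.map {S T : Signature} (i : ∀ {n m}, S n m → T n m) :
    ∀ {n m}, S.Term n m → T.Term n m
  | _, _, .gen o => .gen (i o)
  | _, _, .id n => .id n
  | _, _, .swap m n => .swap m n
  | _, _, .comp s t => .comp (s.map i) (t.map i)
  | _, _, .tensor s t => .tensor (s.map i) (t.map i)

/-- A set of equations over a signature: a set of pairs of terms of equal type, given as a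
relation. -/
def Signature.Equations (S : Signature) := ∀ {n m : ℕ}, S.Term n m → S.Term n m → Prop

/-- A symmetric monoidal theory (SMT): a signature with a set of equations. -/
structure SMT where
  sig : Signature
  eqs : sig.Equations

/-- Equality of terms modulo the equations of the theory and the laws of symmetric strict monoidal
categories. -/
inductive SMT.Rel (T : SMT) : ∀ {n m : ℕ}, T.sig.Term n m → T.sig.Term n m → Prop where
  | ax {n m} {s t : T.sig.Term n m} : T.eqs s t → SMT.Rel T s t
  | refl {n m} (s : T.sig.Term n m) : SMT.Rel T s s
  | symm {n m} {s t : T.sig.Term n m} : SMT.Rel T s t → SMT.Rel T t s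
  | trans {n m} {s t u : T.sig.Term n m} : SMT.Rel T s t → SMT.Rel T t u → SMT.Rel T s u
  | comp_congr {a b c} {s s' : T.sig.Term a b} {t t' : T.sig.Term b c} :
      SMT.Rel T s s' → SMT.Rel T t t' → SMT.Rel T (.comp s t) (.comp s' t')
  | tensor_congr {a b c d} {s s' : T.sig.Term a b} {t t' : T.sig.Term c d} :
      SMT.Rel T s s' → SMT.Rel T t t' → SMT.Rel T (.tensor s t) (.tensor s' t')
  | id_comp {a b} (f : T.sig.Term a b) : SMT.Rel T (.comp (.id a) f) f
  | comp_id {a b} (f : T.sig.Term a b) : SMT.Rel T (.comp f (.id b)) f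
  | comp_assoc {a b c d} (f : T.sig.Term a b) (g : T.sig.Term b c) (h : T.sig.Term c d) :
      SMT.Rel T (.comp (.comp f g) h) (.comp f (.comp g h))
  | tensor_id (a b) : SMT.Rel T (.tensor (.id a) (.id b)) (.id (a + b))
  | tensor_comp {a b c a' b' c'} (f : T.sig.Term a b) (g : T.sig.Term b c)
      (f' : T.sig.Term a' b') (g' : T.sig.Term b' c') :
      SMT.Rel T (.tensor (.comp f g) (.comp f' g')) (.comp (.tensor f f') (.tensor g g'))
  | tensor_assoc {a b c d k l} (f : T.sig.Term a b) (g : T.sig.Term c d) (h : T.sig.Term k l) :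
      SMT.Rel T (castHom T.sig.Term (add_assoc a c k) (add_assoc b d l) (.tensor (.tensor f g) h))
        (.tensor f (.tensor g h))
  | zero_tensor {a b} (f : T.sig.Term a b) :
      SMT.Rel T (castHom T.sig.Term (zero_add a) (zero_add b) (.tensor (.id 0) f)) f
  | tensor_zero {a b} (f : T.sig.Term a b) :
      SMT.Rel T (castHom T.sig.Term (add_zero a) (add_zero b) (.tensor f (.id 0))) f
  | swap_natural {a b c d} (f : T.sig.Term a b) (g : T.sig.Term c d) :
      SMT.Rel T (.comp (.tensor f g) (.swap b d)) (.comp (.swap a c) (.tensor g f))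
  | swap_swap (m n) : SMT.Rel T (.comp (.swap m n) (.swap n m)) (.id (m + n))
  | swap_add (m n k) : SMT.Rel T (.swap m (n + k))
      (.comp (castHom T.sig.Term (add_assoc m n k) (add_assoc n m k) (.tensor (.swap m n) (.id k)))
        (castHom T.sig.Term rfl (add_assoc n k m).symm (.tensor (.id n) (.swap m k))))

/-- Arrows of the PROP generated by a theory: terms modulo `SMT.Rel`. -/
def SMT.Arrow (T : SMT) (n m : ℕ) := Quot (fun s t : T.sig.Term n m => T.Rel s t)

/-- The arrow denoted by a term. -/
def SMT.arrow (T : SMT) {n m : ℕ} (t : T.sig.Term n m) : T.Arrow n m := Quot.mk _ t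

theorem SMT.arrow_cast (T : SMT) {a a' b b' : ℕ} (ha : a = a') (hb : b = b')
    (f : T.sig.Term a b) :
    castHom T.Arrow ha hb (T.arrow f) = T.arrow (castHom T.sig.Term ha hb f) :=
  (castHom_map (X := T.sig.Term) (Y := T.Arrow) (fun t => T.arrow t) ha hb f).symm

/-- Sequential composition of arrows. -/
def SMT.compArrow (T : SMT) {a b c : ℕ} : T.Arrow a b → T.Arrow b c → T.Arrow a c :=
  Quot.map₂ .comp (fun s _ _ h => .comp_congr (.refl s) h) (fun _ _ t h => .comp_congr h (.refl t))

/-- Parallel composition of arrows. -/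
def SMT.tensorArrow (T : SMT) {a b c d : ℕ} :
    T.Arrow a b → T.Arrow c d → T.Arrow (a + c) (b + d) :=
  Quot.map₂ .tensor (fun s _ _ h => .tensor_congr (.refl s) h)
    (fun _ _ t h => .tensor_congr h (.refl t))

/-- The PROP generated by a symmetric monoidal theory. -/
def SMT.prop (T : SMT) : PROP where
  Hom := T.Arrow
  id n := T.arrow (.id n)
  comp := T.compArrow
  tensor := T.tensorArrow
  swap m n := T.arrow (.swap m n)
  id_comp := by rintro _ _ ⟨f⟩; exact Quot.sound (.id_comp f)
  comp_id := by rintro _ _ ⟨f⟩; exact Quot.sound (.comp_id f)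
  comp_assoc := by rintro _ _ _ _ ⟨f⟩ ⟨g⟩ ⟨h⟩; exact Quot.sound (.comp_assoc f g h)
  tensor_id a b := Quot.sound (.tensor_id a b)
  tensor_comp := by
    rintro _ _ _ _ _ _ ⟨f⟩ ⟨g⟩ ⟨f'⟩ ⟨g'⟩; exact Quot.sound (.tensor_comp f g f' g')
  tensor_assoc := by
    rintro _ _ _ _ _ _ ⟨f⟩ ⟨g⟩ ⟨h⟩
    exact (T.arrow_cast _ _ _).trans (Quot.sound (.tensor_assoc f g h))
  zero_tensor := by
    rintro _ _ ⟨f⟩; exact (T.arrow_cast _ _ _).trans (Quot.sound (.zero_tensor f))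
  tensor_zero := by
    rintro _ _ ⟨f⟩; exact (T.arrow_cast _ _ _).trans (Quot.sound (.tensor_zero f))
  swap_natural := by rintro _ _ _ _ ⟨f⟩ ⟨g⟩; exact Quot.sound (.swap_natural f g)
  swap_swap m n := Quot.sound (.swap_swap m n)
  swap_add m n k := by
    refine (Quot.sound (.swap_add m n k) : T.arrow (.swap m (n + k)) = _).trans ?_
    exact congrArg₂ T.compArrow (T.arrow_cast _ _ _).symm (T.arrow_cast _ _ _).symm

/-- The interpretation of terms in a PROP, given an interpretation of the generators. -/
def Signature.Term.eval {S : Signature} (A : PROP) (i : ∀ {n m}, S n m → A.Hom n m) :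
    ∀ {n m}, S.Term n m → A.Hom n m
  | _, _, .gen o => i o
  | _, _, .id n => A.id n
  | _, _, .swap m n => A.swap m n
  | _, _, .comp s t => A.comp (s.eval A i) (t.eval A i)
  | _, _, .tensor s t => A.tensor (s.eval A i) (t.eval A i)

theorem SMT.Rel.eval_eq {T : SMT} {A : PROP} {i : ∀ {n m}, T.sig n m → A.Hom n m}
    (hi : ∀ {n m} (s t : T.sig.Term n m), T.eqs s t → s.eval A i = t.eval A i)
    {n m : ℕ} {s t : T.sig.Term n m} (h : T.Rel s t) : s.eval A i = t.eval A i := by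
  have hc : ∀ {a a' b b' : ℕ} (ha : a = a') (hb : b = b') (f : T.sig.Term a b),
      (castHom T.sig.Term ha hb f).eval A i = castHom A.Hom ha hb (f.eval A i) :=
    fun ha hb f => castHom_map (X := T.sig.Term) (Y := A.Hom) (fun t => t.eval A i) ha hb f
  induction h with
  | ax h => exact hi _ _ h
  | refl => rfl
  | symm _ ih => exact ih.symm
  | trans _ _ ih ih' => exact ih.trans ih'
  | comp_congr _ _ ih ih' => simp only [Signature.Term.eval, ih, ih']
  | tensor_congr _ _ ih ih' => simp only [Signature.Term.eval, ih, ih']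
  | id_comp => exact A.id_comp _
  | comp_id => exact A.comp_id _
  | comp_assoc => exact A.comp_assoc _ _ _
  | tensor_id => exact A.tensor_id _ _
  | tensor_comp => exact A.tensor_comp _ _ _ _
  | tensor_assoc => exact (hc _ _ _).trans (A.tensor_assoc _ _ _)
  | zero_tensor => exact (hc _ _ _).trans (A.zero_tensor _)
  | tensor_zero => exact (hc _ _ _).trans (A.tensor_zero _)
  | swap_natural => exact A.swap_natural _ _
  | swap_swap => exact A.swap_swap _ _
  | swap_add m n k => simpa only [Signature.Term.eval, hc] using A.swap_add m n k

/-! ### The PROP of permutations -/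

/-- The symmetric monoidal theory with no generators and no equations. -/
def SMT.empty : SMT where
  sig := fun _ _ => Empty
  eqs := fun _ _ => False

/-- The PROP of permutations, as the initial PROP: the one generated by the empty theory. Its
arrows `n → n` are the composites of symmetries, and it has no arrows `n → m` for `n ≠ m`. -/
def Perm : PROP := SMT.empty.prop

/-- The unique morphism of PROPs from the PROP of permutations to a PROP `A`. -/
def PROP.ofPerm (A : PROP) : PROP.Mor Perm A where
  toFun := Quot.lift (fun t => t.eval A (fun o => o.elim))
    (fun s t (h : SMT.empty.Rel s t) => h.eval_eq (fun _ _ h => False.elim h))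
  map_id _ := rfl
  map_comp := by rintro _ _ _ ⟨f⟩ ⟨g⟩; rfl
  map_tensor := by rintro _ _ _ _ ⟨f⟩ ⟨g⟩; rfl
  map_swap _ _ := rfl

/-- A permutation, seen as an arrow of the PROP `A`. -/
def PROP.perm (A : PROP) {n m : ℕ} (p : Perm.Hom n m) : A.Hom n m := A.ofPerm.toFun p

theorem PROP.Mor.eq_perm {A : PROP} (φ : PROP.Mor Perm A) {n m : ℕ} (p : Perm.Hom n m) :
    φ.toFun p = A.perm p := by
  obtain ⟨t, rfl⟩ : ∃ t, SMT.empty.arrow t = p := Quot.exists_rep p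
  induction t with
  | gen o => exact o.elim
  | id n => exact φ.map_id n
  | swap m n => exact φ.map_swap m n
  | comp s t hs ht =>
    exact (φ.map_comp (SMT.empty.arrow s) (SMT.empty.arrow t)).trans (by rw [hs, ht]; rfl)
  | tensor s t hs ht =>
    exact (φ.map_tensor (SMT.empty.arrow s) (SMT.empty.arrow t)).trans (by rw [hs, ht]; rfl)

theorem PROP.Mor.map_perm {A B : PROP} (φ : PROP.Mor A B) {n m : ℕ} (p : Perm.Hom n m) :
    φ.toFun (A.perm p) = B.perm p :=
  PROP.Mor.eq_perm (A := B)
    { toFun := fun p => φ.toFun (A.perm p)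
      map_id := fun n => (congrArg φ.toFun (A.ofPerm.map_id n)).trans (φ.map_id n)
      map_comp := fun f g => (congrArg φ.toFun (A.ofPerm.map_comp f g)).trans (φ.map_comp _ _)
      map_tensor := fun f g =>
        (congrArg φ.toFun (A.ofPerm.map_tensor f g)).trans (φ.map_tensor _ _)
      map_swap := fun m n => (congrArg φ.toFun (A.ofPerm.map_swap m n)).trans (φ.map_swap m n) } p

/-! ### Composable pairs and triples of arrows up to permutation -/

/-- Composable pairs `n → mid → m` of an arrow of `A` and an arrow of `B`. -/
structure Pair (A B : PROP) (n m : ℕ) where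
  mid : ℕ
  fst : A.Hom n mid
  snd : B.Hom mid m

/-- `(f ; p, g)` and `(f, p ; g)` are related for every permutation `p`. -/
inductive Pair.Rel {A B : PROP} {n m : ℕ} : Pair A B n m → Pair A B n m → Prop where
  | move {z w : ℕ} (f : A.Hom n z) (p : Perm.Hom z w) (g : B.Hom w m) :
      Pair.Rel ⟨w, A.comp f (A.perm p), g⟩ ⟨z, f, B.comp (B.perm p) g⟩

/-- The composite of `A` and `B` as bimodules over the PROP of permutations: composable pairs,
modulo the equivalence relation generated by `Pair.Rel`. -/
def Comp (A B : PROP) (n m : ℕ) := Quot (Pair.Rel (A := A) (B := B) (n := n) (m := m))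

namespace Comp

/-- The class of a composable pair. -/
def mk {A B : PROP} {n z m : ℕ} (f : A.Hom n z) (g : B.Hom z m) : Comp A B n m :=
  Quot.mk _ ⟨z, f, g⟩

theorem ind {A B : PROP} {n m : ℕ} {P : Comp A B n m → Prop}
    (h : ∀ {z} (f : A.Hom n z) (g : B.Hom z m), P (mk f g)) (x : Comp A B n m) : P x := by
  obtain ⟨_, f, g⟩ := x; exact h f g

theorem move {A B : PROP} {n z w m : ℕ} (f : A.Hom n z) (p : Perm.Hom z w) (g : B.Hom w m) :
    mk (A.comp f (A.perm p)) g = mk f (B.comp (B.perm p) g) :=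
  Quot.sound (.move f p g)

/-- Precomposition with an arrow of `A`. -/
def pre {A B : PROP} {n z m : ℕ} (f : A.Hom n z) (x : Comp A B z m) : Comp A B n m :=
  Quot.lift (fun y => mk (A.comp f y.fst) y.snd)
    (by rintro _ _ ⟨f', p, g⟩; simpa only [A.comp_assoc] using move (A.comp f f') p g) x

/-- Postcomposition with an arrow of `B`. -/
def post {A B : PROP} {n z m : ℕ} (x : Comp A B n z) (g : B.Hom z m) : Comp A B n m :=
  Quot.lift (fun y => mk y.fst (B.comp y.snd g))
    (by rintro _ _ ⟨f, p, g'⟩; simpa only [B.comp_assoc] using move f p (B.comp g' g)) x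

/-- The monoidal product of classes of composable pairs. -/
def tensor {A B : PROP} {a b c d : ℕ} (x : Comp A B a b) (y : Comp A B c d) :
    Comp A B (a + c) (b + d) :=
  Quot.map₂ (fun x y => ⟨_, A.tensor x.fst y.fst, B.tensor x.snd y.snd⟩)
    (by
      rintro ⟨w, f, g⟩ _ _ ⟨f', p, g'⟩
      have := Pair.Rel.move (A.tensor f f') (Perm.tensor (Perm.id w) p) (B.tensor g g')
      simpa only [PROP.perm, PROP.Mor.map_tensor, PROP.Mor.map_id, ← PROP.tensor_comp,
        PROP.comp_id, PROP.id_comp] using this)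
    (by
      rintro _ _ ⟨w, f, g⟩ ⟨f', p, g'⟩
      have := Pair.Rel.move (A.tensor f' f) (Perm.tensor p (Perm.id w)) (B.tensor g' g)
      simpa only [PROP.perm, PROP.Mor.map_tensor, PROP.Mor.map_id, ← PROP.tensor_comp,
        PROP.comp_id, PROP.id_comp] using this) x y

end Comp

/-- Composable triples `n → mid₁ → mid₂ → m` of arrows of `A`, `B` and `C`. -/
structure Triple (A B C : PROP) (n m : ℕ) where
  mid₁ : ℕ
  mid₂ : ℕ
  fst : A.Hom n mid₁
  snd : B.Hom mid₁ mid₂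
  thd : C.Hom mid₂ m

/-- Permutations may be moved between adjacent arrows of a composable triple. -/
inductive Triple.Rel {A B C : PROP} {n m : ℕ} : Triple A B C n m → Triple A B C n m → Prop where
  | move₁ {z w v : ℕ} (f : A.Hom n z) (p : Perm.Hom z w) (g : B.Hom w v) (h : C.Hom v m) :
      Triple.Rel ⟨w, v, A.comp f (A.perm p), g, h⟩ ⟨z, v, f, B.comp (B.perm p) g, h⟩
  | move₂ {z w v : ℕ} (f : A.Hom n z) (g : B.Hom z w) (p : Perm.Hom w v) (h : C.Hom v m) :
      Triple.Rel ⟨z, v, f, B.comp g (B.perm p), h⟩ ⟨z, w, f, g, C.comp (C.perm p) h⟩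

/-- The composite of three PROPs as bimodules over the PROP of permutations. -/
def Comp₃ (A B C : PROP) (n m : ℕ) :=
  Quot (Triple.Rel (A := A) (B := B) (C := C) (n := n) (m := m))

namespace Comp₃

/-- The class of a composable triple. -/
def mk {A B C : PROP} {n z w m : ℕ} (f : A.Hom n z) (g : B.Hom z w) (h : C.Hom w m) :
    Comp₃ A B C n m :=
  Quot.mk _ ⟨z, w, f, g, h⟩

theorem move₁ {A B C : PROP} {n z w v m : ℕ} (f : A.Hom n z) (p : Perm.Hom z w)
    (g : B.Hom w v) (h : C.Hom v m) :
    mk (A.comp f (A.perm p)) g h = mk f (B.comp (B.perm p) g) h :=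
  Quot.sound (.move₁ f p g h)

theorem move₂ {A B C : PROP} {n z w v m : ℕ} (f : A.Hom n z) (g : B.Hom z w)
    (p : Perm.Hom w v) (h : C.Hom v m) :
    mk f (B.comp g (B.perm p)) h = mk f g (C.comp (C.perm p) h) :=
  Quot.sound (.move₂ f g p h)

/-- `([f, g], h) ↦ [f, g, h]`. -/
def ofLeft {A B C : PROP} {n z m : ℕ} (x : Comp A B n z) (h : C.Hom z m) : Comp₃ A B C n m :=
  Quot.lift (fun y => mk y.fst y.snd h) (by rintro _ _ ⟨f, p, g⟩; exact move₁ f p g h) x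

/-- `(f, [g, h]) ↦ [f, g, h]`. -/
def ofRight {A B C : PROP} {n z m : ℕ} (f : A.Hom n z) (x : Comp B C z m) : Comp₃ A B C n m :=
  Quot.lift (fun y => mk f y.fst y.snd) (by rintro _ _ ⟨g, p, h⟩; exact move₂ f g p h) x

theorem ofLeft_post {A B C : PROP} {n z w m : ℕ} (x : Comp A B n z) (p : Perm.Hom z w)
    (h : C.Hom w m) : ofLeft (x.post (B.perm p)) h = ofLeft x (C.comp (C.perm p) h) := by
  induction x using Comp.ind with | h f g => exact move₂ f g p h

theorem ofRight_pre {A B C : PROP} {n z w m : ℕ} (f : A.Hom n z) (p : Perm.Hom z w)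
    (x : Comp B C w m) : ofRight (A.comp f (A.perm p)) x = ofRight f (x.pre (B.perm p)) := by
  induction x using Comp.ind with | h g h => exact move₁ f p g h

/-- The multiplication of `A`, whiskered with `B`: `[f, f', g] ↦ [f ; f', g]`. -/
def mulLeft {A B : PROP} {n m : ℕ} : Comp₃ A A B n m → Comp A B n m :=
  Quot.lift (fun x => Comp.mk (A.comp x.fst x.snd) x.thd) (by
    rintro _ _ (⟨f, p, g, h⟩ | ⟨f, g, p, h⟩)
    · simp only [A.comp_assoc]
    · simpa only [A.comp_assoc] using Comp.move (A.comp f g) p h)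

/-- The multiplication of `B`, whiskered with `A`: `[f, g, g'] ↦ [f, g ; g']`. -/
def mulRight {A B : PROP} {n m : ℕ} : Comp₃ A B B n m → Comp A B n m :=
  Quot.lift (fun x => Comp.mk x.fst (B.comp x.snd x.thd)) (by
    rintro _ _ (⟨f, p, g, h⟩ | ⟨f, g, p, h⟩)
    · simpa only [B.comp_assoc] using Comp.move f p (B.comp g h)
    · simp only [B.comp_assoc])

end Comp₃

/-! ### Distributive laws -/

/-- A morphism `A ; B → B ; A` of bimodules over the PROP of permutations (in spans of monoids):
it preserves source, target, the monoidal product and its unit, and both actions of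
permutations. -/
structure Cell (A B : PROP) where
  toFun : ∀ {n m}, Comp A B n m → Comp B A n m
  map_unit : toFun (Comp.mk (A.id 0) (B.id 0)) = Comp.mk (B.id 0) (A.id 0)
  map_tensor : ∀ {a b c d} (x : Comp A B a b) (y : Comp A B c d),
    toFun (x.tensor y) = (toFun x).tensor (toFun y)
  map_pre : ∀ {n z m} (p : Perm.Hom n z) (x : Comp A B z m),
    toFun (x.pre (A.perm p)) = (toFun x).pre (B.perm p)
  map_post : ∀ {n z m} (x : Comp A B n z) (p : Perm.Hom z m),
    toFun (x.post (B.perm p)) = (toFun x).post (A.perm p)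

/-- `c C : A ; B ; C → B ; A ; C`. -/
def Cell.whiskerRight {A B : PROP} (c : Cell A B) (C : PROP) {n m : ℕ} :
    Comp₃ A B C n m → Comp₃ B A C n m :=
  Quot.lift (fun x => Comp₃.ofLeft (c.toFun (Comp.mk x.fst x.snd)) x.thd) (by
    rintro _ _ (⟨f, p, g, h⟩ | ⟨f, g, p, h⟩)
    · simp only [Comp.move]
    · have := c.map_post (Comp.mk f g) p
      rw [← Comp₃.ofLeft_post, ← this]; rfl)

/-- `C c : C ; A ; B → C ; B ; A`. -/
def Cell.whiskerLeft {A B : PROP} (C : PROP) (c : Cell A B) {n m : ℕ} :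
    Comp₃ C A B n m → Comp₃ C B A n m :=
  Quot.lift (fun x => Comp₃.ofRight x.fst (c.toFun (Comp.mk x.snd x.thd))) (by
    rintro _ _ (⟨f, p, g, h⟩ | ⟨f, g, p, h⟩)
    · have := c.map_pre p (Comp.mk g h)
      rw [Comp₃.ofRight_pre, ← this]; rfl
    · simp only [Comp.move])

/-- A distributive law `A ; B → B ; A` of the PROP `A` over the PROP `B`. -/
structure DistLaw (A B : PROP) extends Cell A B where
  unit_right : ∀ {n m} (f : A.Hom n m), toFun (Comp.mk f (B.id m)) = Comp.mk (B.id n) f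
  unit_left : ∀ {n m} (g : B.Hom n m), toFun (Comp.mk (A.id n) g) = Comp.mk g (A.id m)
  mul_right : ∀ {n m} (x : Comp₃ A B B n m),
    toFun x.mulRight = (toCell.whiskerLeft B (toCell.whiskerRight B x)).mulLeft
  mul_left : ∀ {n m} (x : Comp₃ A A B n m),
    toFun x.mulLeft = (toCell.whiskerRight A (toCell.whiskerLeft A x)).mulRight

namespace Comp

theorem cast_mk {A B : PROP} {n n' z z' m m' : ℕ} (hn : n = n') (hz : z = z') (hm : m = m')
    (f : A.Hom n z) (g : B.Hom z m) :
    castHom (Comp A B) hn hm (mk f g) = mk (castHom A.Hom hn hz f) (castHom B.Hom hz hm g) := by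
  subst hn hz hm; rfl

theorem pre_pre {A B : PROP} {n z w m : ℕ} (f : A.Hom n z) (f' : A.Hom z w) (x : Comp A B w m) :
    (x.pre f').pre f = x.pre (A.comp f f') := by
  induction x using Comp.ind with | h g h => exact congrArg (mk · h) (A.comp_assoc _ _ _).symm

theorem post_post {A B : PROP} {n z w m : ℕ} (x : Comp A B n z) (g : B.Hom z w)
    (g' : B.Hom w m) : (x.post g).post g' = x.post (B.comp g g') := by
  induction x using Comp.ind with | h f h => exact congrArg (mk f) (B.comp_assoc _ _ _)

theorem pre_post {A B : PROP} {n z w m : ℕ} (f : A.Hom n z) (x : Comp A B z w) (g : B.Hom w m) :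
    (x.pre f).post g = (x.post g).pre f := by
  induction x using Comp.ind with | h f h => rfl

theorem tensor_pre {A B : PROP} {a b c a' b' c' : ℕ} (f : A.Hom a b) (x : Comp A B b c)
    (f' : A.Hom a' b') (x' : Comp A B b' c') :
    (x.pre f).tensor (x'.pre f') = (x.tensor x').pre (A.tensor f f') := by
  induction x using Comp.ind with | h g h => ?_
  induction x' using Comp.ind with | h g' h' => ?_
  exact congrArg (mk · (B.tensor h h')) (A.tensor_comp _ _ _ _)

theorem tensor_post {A B : PROP} {a b c a' b' c' : ℕ} (x : Comp A B a b) (g : B.Hom b c)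
    (x' : Comp A B a' b') (g' : B.Hom b' c') :
    (x.post g).tensor (x'.post g') = (x.tensor x').post (B.tensor g g') := by
  induction x using Comp.ind with | h f h => ?_
  induction x' using Comp.ind with | h f' h' => ?_
  exact congrArg (mk (A.tensor f f')) (B.tensor_comp _ _ _ _)

theorem pre_id {A B : PROP} {n m : ℕ} (x : Comp A B n m) : x.pre (A.id n) = x := by
  induction x using Comp.ind with | h f g => exact congrArg (mk · g) (A.id_comp f)

theorem post_id {A B : PROP} {n m : ℕ} (x : Comp A B n m) : x.post (B.id m) = x := by
  induction x using Comp.ind with | h f g => exact congrArg (mk f) (B.comp_id g)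

theorem mk_eq_pre {A B : PROP} {n z m : ℕ} (f : A.Hom n z) (g : B.Hom z m) :
    mk f g = (mk (A.id z) g).pre f := congrArg (mk · g) (A.comp_id f).symm

theorem mk_eq_post {A B : PROP} {n z m : ℕ} (f : A.Hom n z) (g : B.Hom z m) :
    mk f g = (mk f (B.id z)).post g := congrArg (mk f) (B.id_comp g).symm

theorem mk_tensor_mk {A B : PROP} {a b c a' b' c' : ℕ} (f : A.Hom a b) (g : B.Hom b c)
    (f' : A.Hom a' b') (g' : B.Hom b' c') :
    (mk f g).tensor (mk f' g') = mk (A.tensor f f') (B.tensor g g') := rfl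

/-- A permutation in the middle belongs to either side. -/
theorem perm_mk {A B : PROP} {n m : ℕ} (p : Perm.Hom n m) :
    (mk (A.perm p) (B.id m) : Comp A B n m) = mk (A.id n) (B.perm p) := by
  have := move (A.id n) p (B.id m)
  rwa [A.id_comp, B.comp_id] at this

end Comp

namespace DistLaw

/-- Composition of the composed PROP, on classes of pairs: `[f, g] ; [f', g']` is
`[f ; f'', g'' ; g']`, where the law sends `[g, f']` to `[f'', g'']`. -/
def compose {A B : PROP} (l : DistLaw B A) {a b c : ℕ} (x : Comp A B a b) (y : Comp A B b c) :
    Comp A B a c :=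
  Quot.lift₂ (fun x y => ((l.toFun (Comp.mk x.snd y.fst)).pre x.fst).post y.snd)
    (by
      rintro ⟨w, f, g⟩ _ _ ⟨f', p, g'⟩
      have := l.map_post (Comp.mk g f') p
      simp only [← Comp.post_post, Comp.pre_post, ← this]; rfl)
    (by
      rintro _ _ ⟨w, f, g⟩ ⟨f', p, g'⟩
      have := l.map_pre p (Comp.mk g' f)
      simp only [← Comp.pre_pre, ← this]; rfl) x y

theorem compose_mk {A B : PROP} (l : DistLaw B A) {a b c z w : ℕ} (f : A.Hom a z) (g : B.Hom z b)
    (f' : A.Hom b w) (g' : B.Hom w c) :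
    l.compose (.mk f g) (.mk f' g') = ((l.toFun (.mk g f')).pre f).post g' := rfl

theorem map_comp_right {A B : PROP} (l : DistLaw B A) {a b c d : ℕ} (g : B.Hom a b)
    (f : A.Hom b c) (f' : A.Hom c d) :
    l.toFun (.mk g (A.comp f f')) = l.compose (l.toFun (.mk g f)) (.mk f' (B.id d)) := by
  refine (l.mul_right (Comp₃.mk g f f')).trans ?_
  change ((l.toCell.whiskerLeft A (Comp₃.ofLeft (l.toFun (.mk g f)) f')).mulLeft) = _
  generalize l.toFun (.mk g f) = x
  induction x using Comp.ind with | h h k => ?_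
  change (Comp₃.ofRight h (l.toFun (.mk k f'))).mulLeft = _
  rw [compose_mk]
  generalize l.toFun (.mk k f') = y
  induction y using Comp.ind with | h h' k' => ?_
  exact congrArg (Comp.mk _) (B.comp_id k').symm

theorem map_comp_left {A B : PROP} (l : DistLaw B A) {a b c d : ℕ} (g : B.Hom a b)
    (g' : B.Hom b c) (f : A.Hom c d) :
    l.toFun (.mk (B.comp g g') f) = l.compose (.mk (A.id a) g) (l.toFun (.mk g' f)) := by
  refine (l.mul_left (Comp₃.mk g g' f)).trans ?_
  change ((l.toCell.whiskerRight B (Comp₃.ofRight g (l.toFun (.mk g' f)))).mulRight) = _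
  generalize l.toFun (.mk g' f) = x
  induction x using Comp.ind with | h h k => ?_
  change (Comp₃.ofLeft (l.toFun (.mk g h)) k).mulRight = _
  rw [compose_mk]
  generalize l.toFun (.mk g h) = y
  induction y using Comp.ind with | h h' k' => ?_
  exact congrArg (Comp.mk · (B.comp k' k)) (A.id_comp h').symm

theorem compose_pre {A B : PROP} (l : DistLaw B A) {a b c d : ℕ} (f : A.Hom a b)
    (x : Comp A B b c) (y : Comp A B c d) :
    l.compose (x.pre f) y = (l.compose x y).pre f := by
  induction x using Comp.ind with | h g h => ?_
  induction y using Comp.ind with | h g' h' => ?_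
  change ((l.toFun _).pre _).post _ = (((l.toFun _).pre _).post _).pre _
  rw [← Comp.pre_post, Comp.pre_pre]

theorem compose_post {A B : PROP} (l : DistLaw B A) {a b c d : ℕ} (x : Comp A B a b)
    (y : Comp A B b c) (g : B.Hom c d) :
    l.compose x (y.post g) = (l.compose x y).post g := by
  induction x using Comp.ind with | h f h => ?_
  induction y using Comp.ind with | h f' h' => ?_
  change ((l.toFun _).pre _).post _ = (((l.toFun _).pre _).post _).post _
  rw [Comp.post_post]

theorem compose_assoc {A B : PROP} (l : DistLaw B A) {a b c d : ℕ} (x : Comp A B a b)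
    (y : Comp A B b c) (z : Comp A B c d) :
    l.compose (l.compose x y) z = l.compose x (l.compose y z) := by
  induction x using Comp.ind with | h f g => ?_
  induction y using Comp.ind with | h f' g' => ?_
  induction z using Comp.ind with | h f'' g'' => ?_
  rw [compose_mk, compose_mk, Comp.pre_post, compose_pre, compose_post, Comp.mk_eq_pre f g,
    Comp.mk_eq_post f'' g'', compose_post, compose_pre, Comp.pre_post]
  congr 2
  have h₁ : ∀ {n} (u : Comp A B n _), l.compose (u.post g') (.mk f'' (B.id _)) =
      l.compose u (l.toFun (.mk g' f'')) := by
    intro n u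
    induction u using Comp.ind with | h u v => ?_
    rw [Comp.mk_eq_pre u v, compose_pre, ← map_comp_left, Comp.pre_post, compose_pre]
    change ((Comp.post (Comp.pre (A.id _) _) (B.id _)).pre _) = _
    rw [Comp.pre_id, Comp.post_id]
  rw [h₁]
  generalize l.toFun (.mk g' f'') = u
  induction u using Comp.ind with | h u v => ?_
  change _ = l.compose _ (.mk (A.comp f' u) v)
  rw [Comp.mk_eq_post u v, Comp.mk_eq_post (A.comp f' u) v, compose_post, compose_post,
    ← map_comp_right, compose_mk, Comp.pre_id, Comp.post_id]

theorem id_compose {A B : PROP} (l : DistLaw B A) {a b : ℕ} (x : Comp A B a b) :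
    l.compose (.mk (A.id a) (B.id a)) x = x := by
  induction x using Comp.ind with | h f g => ?_
  rw [compose_mk, l.unit_left, Comp.pre_id]
  exact congrArg (Comp.mk f) (B.id_comp g)

theorem compose_id {A B : PROP} (l : DistLaw B A) {a b : ℕ} (x : Comp A B a b) :
    l.compose x (.mk (A.id b) (B.id b)) = x := by
  induction x using Comp.ind with | h f g => ?_
  rw [compose_mk, l.unit_right, Comp.post_id]
  exact congrArg (Comp.mk · g) (A.comp_id f)

theorem compose_left {A B : PROP} (l : DistLaw B A) {a b c : ℕ} (f : A.Hom a b)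
    (x : Comp A B b c) : l.compose (.mk f (B.id b)) x = x.pre f := by
  rw [Comp.mk_eq_pre, compose_pre, id_compose]

theorem compose_right {A B : PROP} (l : DistLaw B A) {a b c : ℕ} (x : Comp A B a b)
    (g : B.Hom b c) : l.compose x (.mk (A.id b) g) = x.post g := by
  rw [Comp.mk_eq_post, compose_post, compose_id]

theorem tensor_compose {A B : PROP} (l : DistLaw B A) {a b c a' b' c' : ℕ} (x : Comp A B a b)
    (y : Comp A B b c) (x' : Comp A B a' b') (y' : Comp A B b' c') :
    (l.compose x y).tensor (l.compose x' y') = l.compose (x.tensor x') (y.tensor y') := by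
  induction x using Comp.ind with | h f g => ?_
  induction y using Comp.ind with | h h k => ?_
  induction x' using Comp.ind with | h f' g' => ?_
  induction y' using Comp.ind with | h h' k' => ?_
  simp only [compose_mk, Comp.mk_tensor_mk, Comp.tensor_pre, Comp.tensor_post, ← l.map_tensor]

theorem perm_swap {A : PROP} (m n : ℕ) : A.perm (Perm.swap m n) = A.swap m n :=
  A.ofPerm.map_swap m n

theorem swap_mk {A B : PROP} (m n : ℕ) :
    (Comp.mk (A.swap m n) (B.id (n + m)) : Comp A B _ _) = Comp.mk (A.id (m + n)) (B.swap m n) := by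
  rw [← perm_swap (A := A), ← perm_swap (A := B), Comp.perm_mk]

/-- The composed PROP `A ; B` of a distributive law `B ; A → A ; B`: its arrows are composable
pairs of an arrow of `A` and an arrow of `B`, up to permutation. -/
def prop {A B : PROP} (l : DistLaw B A) : PROP where
  Hom := Comp A B
  id n := .mk (A.id n) (B.id n)
  comp := l.compose
  tensor := Comp.tensor
  swap m n := .mk (A.swap m n) (B.id (n + m))
  id_comp := l.id_compose
  comp_id := l.compose_id
  comp_assoc := l.compose_assoc
  tensor_id a b := by rw [Comp.mk_tensor_mk, A.tensor_id, B.tensor_id]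
  tensor_comp := l.tensor_compose
  tensor_assoc x y z := by
    induction x using Comp.ind with | h f g => ?_
    induction y using Comp.ind with | h f' g' => ?_
    induction z using Comp.ind with | h f'' g'' => ?_
    simp only [Comp.mk_tensor_mk]
    rw [Comp.cast_mk _ (add_assoc _ _ _), A.tensor_assoc, B.tensor_assoc]
  zero_tensor x := by
    induction x using Comp.ind with | h f g => ?_
    rw [Comp.mk_tensor_mk, Comp.cast_mk _ (zero_add _), A.zero_tensor, B.zero_tensor]
  tensor_zero x := by
    induction x using Comp.ind with | h f g => ?_
    rw [Comp.mk_tensor_mk, Comp.cast_mk _ (add_zero _), A.tensor_zero, B.tensor_zero]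
  swap_natural x y := by
    induction x using Comp.ind with | h f g => ?_
    induction y using Comp.ind with | h f' g' => ?_
    rw [Comp.mk_tensor_mk, Comp.mk_tensor_mk, compose_left, swap_mk, compose_right]
    change Comp.mk _ (B.comp _ _) = Comp.mk (A.comp _ _) _
    have := Comp.move (A.tensor f f') (Perm.swap _ _) (B.tensor g' g)
    rw [perm_swap, perm_swap] at this
    rw [B.swap_natural, ← A.swap_natural]
    exact this.symm
  swap_swap m n := by
    rw [compose_left]
    change Comp.mk (A.comp _ _) _ = _
    rw [A.swap_swap]
  swap_add m n k := by
    rw [Comp.mk_tensor_mk, Comp.mk_tensor_mk, Comp.cast_mk _ (add_assoc n m k),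
      Comp.cast_mk rfl (add_assoc n k m).symm, B.tensor_id, B.tensor_id]
    have h : ∀ {a b} (h : a = b), castHom B.Hom h h (B.id a) = B.id b := by rintro _ _ rfl; rfl
    rw [h, h, compose_left]
    change _ = Comp.mk (A.comp _ _) _
    rw [← A.swap_add]

/-- The inclusion `f ↦ [f, id]` of `A` in `A ; B`. -/
def inl {A B : PROP} (l : DistLaw B A) : PROP.Mor A l.prop where
  toFun {_ m} f := Comp.mk f (B.id m)
  map_id _ := rfl
  map_comp f g := (l.compose_left f (Comp.mk g (B.id _))).symm
  map_tensor f g := ((Comp.mk_tensor_mk _ _ _ _).trans (by rw [B.tensor_id])).symm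
  map_swap _ _ := rfl

/-- The inclusion `g ↦ [id, g]` of `B` in `A ; B`. -/
def inr {A B : PROP} (l : DistLaw B A) : PROP.Mor B l.prop where
  toFun {n _} g := Comp.mk (A.id n) g
  map_id _ := rfl
  map_comp f g := (l.compose_right (Comp.mk (A.id _) f) g).symm
  map_tensor f g := ((Comp.mk_tensor_mk _ _ _ _).trans (by rw [A.tensor_id])).symm
  map_swap m n := (swap_mk m n).symm

theorem perm_comp {A B : PROP} (l : DistLaw B A) {n z m : ℕ} (p : Perm.Hom n z)
    (x : l.prop.Hom z m) : l.prop.comp (l.prop.perm p) x = Comp.pre (A.perm p) x := by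
  rw [← l.inl.map_perm]; exact l.compose_left _ x

theorem comp_perm {A B : PROP} (l : DistLaw B A) {n z m : ℕ} (x : l.prop.Hom n z)
    (p : Perm.Hom z m) : l.prop.comp x (l.prop.perm p) = Comp.post x (B.perm p) := by
  rw [← l.inr.map_perm]; exact l.compose_right x _

/-- Rebracketing `A ; B ; C → (A ; B) ; C`: `[f, g, h] ↦ [[f, g], h]`, where `A ; B` carries the
structure of composed PROP given by the law `l`. -/
def assocLeft {A B : PROP} (l : DistLaw B A) (C : PROP) {n m : ℕ} :
    Comp₃ A B C n m → Comp l.prop C n m :=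
  Quot.lift (fun x => Comp.mk (A := l.prop) (Comp.mk x.fst x.snd) x.thd) (by
    rintro _ _ (⟨f, p, g, h⟩ | ⟨f, g, p, h⟩)
    · simp only [Comp.move]
    · have := Comp.move (A := l.prop) (Comp.mk f g) p h
      exact (congrArg (Comp.mk (A := l.prop) · h) (l.comp_perm (Comp.mk f g) p).symm).trans this)

/-- Rebracketing `A ; B ; C → A ; (B ; C)`: `[f, g, h] ↦ [f, [g, h]]`, where `B ; C` carries the
structure of composed PROP given by the law `l`. -/
def assocRight {B C : PROP} (A : PROP) (l : DistLaw C B) {n m : ℕ} :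
    Comp₃ A B C n m → Comp A l.prop n m :=
  Quot.lift (fun x => Comp.mk (B := l.prop) x.fst (Comp.mk x.snd x.thd)) (by
    rintro _ _ (⟨f, p, g, h⟩ | ⟨f, g, p, h⟩)
    · have := Comp.move (B := l.prop) f p (Comp.mk g h)
      exact this.trans (congrArg (Comp.mk (B := l.prop) f) (l.perm_comp p (Comp.mk g h)))
    · simp only [Comp.move])

end DistLaw

/-- The Yang-Baxter equation for `lam : H ; F → F ; H`, `chi : H ; G → G ; H` and
`psi : G ; F → F ; G`: the two morphisms `H ; G ; F → F ; G ; H` built from them are equal. -/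
def YangBaxter {F G H : PROP} (lam : DistLaw H F) (chi : DistLaw H G) (psi : DistLaw G F) : Prop :=
  ∀ {n m : ℕ} (x : Comp₃ H G F n m),
    chi.toCell.whiskerLeft F (lam.toCell.whiskerRight G (psi.toCell.whiskerLeft H x)) =
      psi.toCell.whiskerRight H (lam.toCell.whiskerLeft G (chi.toCell.whiskerRight F x))

/-! ### Presentations of composed PROPs -/

/-- The equations `E`, with generators renamed along `i`. -/
inductive Signature.Equations.map {S S' : Signature} (i : ∀ {n m}, S n m → S' n m)
    (E : S.Equations) : ∀ {n m : ℕ}, S'.Term n m → S'.Term n m → Prop where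
  | mk {n m : ℕ} (s t : S.Term n m) : E s t →
      Signature.Equations.map i E (s.map i) (t.map i)

/-- A presentation of the PROP `A` by the theory `T`: an isomorphism to `A` from the PROP that `T`
generates. -/
def Presentation (T : SMT) (A : PROP) := PROP.Iso T.prop A

/-- The arrow of `A` that a term denotes. -/
def Presentation.interp {T : SMT} {A : PROP} (P : Presentation T A) {n m : ℕ}
    (t : T.sig.Term n m) : A.Hom n m :=
  P.toFun (T.arrow t)

/-- The equations encoded by a distributive law `l : B ; A → A ; B` of presented PROPs, as
equations between terms of a signature `S` which contains those of `A` and `B`: there is an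
equation `g ; f = f' ; g'` whenever `l` sends `[g, f]` to `[f', g']`. -/
inductive DistLaw.Eqs {A B : PROP} {TA TB : SMT} (PA : Presentation TA A)
    (PB : Presentation TB B) (l : DistLaw B A) {S : Signature}
    (iA : ∀ {n m}, TA.sig n m → S n m) (iB : ∀ {n m}, TB.sig n m → S n m) :
    ∀ {n m : ℕ}, S.Term n m → S.Term n m → Prop where
  | mk {n z w m : ℕ} (g : TB.sig.Term n z) (f : TA.sig.Term z m)
      (f' : TA.sig.Term n w) (g' : TB.sig.Term w m) :
      l.toFun (.mk (PB.interp g) (PA.interp f)) = .mk (PA.interp f') (PB.interp g') →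
      DistLaw.Eqs PA PB l iA iB (.comp (g.map iB) (f.map iA)) (.comp (f'.map iA) (g'.map iB))

namespace Signature

variable {F G H : Signature} {n m : ℕ}

/-- Inclusion of the first of three signatures in their disjoint union. -/
def in₁ (o : F n m) : ((F.sum G).sum H) n m := Sum.inl (Sum.inl o)

/-- Inclusion of the second of three signatures in their disjoint union. -/
def in₂ (o : G n m) : ((F.sum G).sum H) n m := Sum.inl (Sum.inr o)

/-- Inclusion of the third of three signatures in their disjoint union. -/
def in₃ (o : H n m) : ((F.sum G).sum H) n m := Sum.inr o

end Signature

/-- The theory whose signature is the disjoint union of those of `TF`, `TG` and `TH`, and whose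
equations are those of `TF`, `TG` and `TH` and those encoded by the three distributive laws. -/
def iteratedTheory {F G H : PROP} {TF TG TH : SMT} (PF : Presentation TF F)
    (PG : Presentation TG G) (PH : Presentation TH H) (lam : DistLaw H F) (chi : DistLaw H G)
    (psi : DistLaw G F) : SMT where
  sig := (TF.sig.sum TG.sig).sum TH.sig
  eqs {_ _} s t :=
    Signature.Equations.map Signature.in₁ TF.eqs s t ∨
      Signature.Equations.map Signature.in₂ TG.eqs s t ∨
      Signature.Equations.map Signature.in₃ TH.eqs s t ∨
      lam.Eqs PF PH Signature.in₁ Signature.in₃ s t ∨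
      chi.Eqs PG PH Signature.in₂ Signature.in₃ s t ∨
      psi.Eqs PF PG Signature.in₁ Signature.in₂ s t

/-! A distributive law `B ; A → A ; B` is the reordering rule of a PROP in which every arrow factors
as an arrow coming from `A` followed by one coming from `B`, uniquely up to a permutation in the
middle. Conversely, such a factorization yields a law (`DistLaw.ofFactorization`): Beck's axioms
then follow from associativity and units in the ambient PROP. Hence only one of the two composite
laws has to be built by hand.

That one is `α`, which moves an arrow of `H` past `f` by `lam` and then past `g` by `chi`. Its
compatibility with units, monoidal product, permutations and composition in `H` is inherited from
the two laws. The substance is its compatibility with composition in `F ; G` (`cross_comp`). Arrows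
of `F ; G` are composites of arrows from `F` and from `G`, so this splits into three cases. A last
factor from `G` is handled by multiplicativity of `chi` (`cross_comp_inr`), and a first factor from
`F` by multiplicativity of `lam` (`cross_inl_comp`). There remains an arrow `g` of `G` followed by
an arrow `f` of `F`. Their composite in `F ; G` is `psi [g, f]`, and the axiom becomes the
Yang-Baxter equation at `[h, g, f]` (`cross_inr_comp_inl`).

In the PROP of `α` every arrow is a composite of some `f`, `g` and `h`. Read as `f` followed by the
composite of `g` and `h`, this is a factorization through `F` and `G ; H`, which yields `β` and the
isomorphism together. The formula for `β` results from reordering `g`, `h`, `f` inside that PROP.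

For the presentation, three morphisms from `F`, `G` and `H` that are compatible with the three laws
extend to `(F ; G) ; H` (`iterateDesc`). The PROP of the theory receives such morphisms, since the
equations of the laws hold there and every arrow of a presented PROP is denoted by a term
(`copair_rename`). Conversely `(F ; G) ; H` satisfies all the equations of the theory. The two
resulting morphisms are mutually inverse, as is checked on composites of `f`, `g`, `h` and on
generators. -/

/-! ### Morphisms on composable pairs, and inverses of isomorphisms. -/

namespace PROP.Mor

/-- The composite of two morphisms of PROPs. -/
def comp {A B C : PROP} (φ : PROP.Mor A B) (ψ : PROP.Mor B C) : PROP.Mor A C where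
  toFun f := ψ.toFun (φ.toFun f)
  map_id n := by rw [φ.map_id, ψ.map_id]
  map_comp f g := by rw [φ.map_comp, ψ.map_comp]
  map_tensor f g := by rw [φ.map_tensor, ψ.map_tensor]
  map_swap m n := by rw [φ.map_swap, ψ.map_swap]

/-- Two morphisms into a common PROP, applied to a composable pair: `[f, g] ↦ i f ; j g`. -/
def copair {A B C : PROP} (i : PROP.Mor A C) (j : PROP.Mor B C) {n m : ℕ} :
    Comp A B n m → C.Hom n m :=
  Quot.lift (fun x => C.comp (i.toFun x.fst) (j.toFun x.snd)) (by
    rintro _ _ ⟨f, p, g⟩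
    -- Morphisms of PROPs preserve permutations, so `p` has the same image in `C` on whichever side
    -- it is counted.
    simp only [i.map_comp, j.map_comp, i.map_perm, j.map_perm, C.comp_assoc])

theorem copair_mk {A B C : PROP} (i : PROP.Mor A C) (j : PROP.Mor B C) {n z m : ℕ}
    (f : A.Hom n z) (g : B.Hom z m) :
    copair i j (.mk f g) = C.comp (i.toFun f) (j.toFun g) := rfl

theorem copair_pre {A B C : PROP} (i : PROP.Mor A C) (j : PROP.Mor B C) {n z m : ℕ}
    (f : A.Hom n z) (x : Comp A B z m) :
    copair i j (x.pre f) = C.comp (i.toFun f) (copair i j x) := by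
  induction x using Comp.ind with | h f' g => ?_
  change C.comp (i.toFun (A.comp f f')) _ = C.comp _ (C.comp _ _)
  rw [i.map_comp, C.comp_assoc]

theorem copair_post {A B C : PROP} (i : PROP.Mor A C) (j : PROP.Mor B C) {n z m : ℕ}
    (x : Comp A B n z) (g : B.Hom z m) :
    copair i j (x.post g) = C.comp (copair i j x) (j.toFun g) := by
  induction x using Comp.ind with | h f g' => ?_
  change C.comp _ (j.toFun (B.comp g' g)) = C.comp (C.comp _ _) _
  rw [j.map_comp, C.comp_assoc]

theorem copair_tensor {A B C : PROP} (i : PROP.Mor A C) (j : PROP.Mor B C) {a b c d : ℕ}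
    (x : Comp A B a b) (y : Comp A B c d) :
    copair i j (x.tensor y) = C.tensor (copair i j x) (copair i j y) := by
  induction x using Comp.ind with | h f g => ?_
  induction y using Comp.ind with | h f' g' => ?_
  simp only [Comp.mk_tensor_mk, copair_mk, i.map_tensor, j.map_tensor, C.tensor_comp]

end PROP.Mor

namespace PROP.Iso

/-- The inverse of an isomorphism of PROPs. -/
noncomputable def symm {A B : PROP} (e : PROP.Iso A B) : PROP.Iso B A where
  toFun {n m} := (Equiv.ofBijective _ (e.bijective n m)).symm
  map_id n := by rw [Equiv.symm_apply_eq]; exact (e.map_id n).symm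
  map_comp f g := by
    rw [Equiv.symm_apply_eq]
    refine .trans ?_ (e.map_comp _ _).symm
    exact congrArg₂ B.comp (Equiv.ofBijective_apply_symm_apply _ (e.bijective _ _) f).symm
      (Equiv.ofBijective_apply_symm_apply _ (e.bijective _ _) g).symm
  map_tensor f g := by
    rw [Equiv.symm_apply_eq]
    refine .trans ?_ (e.map_tensor _ _).symm
    exact congrArg₂ B.tensor (Equiv.ofBijective_apply_symm_apply _ (e.bijective _ _) f).symm
      (Equiv.ofBijective_apply_symm_apply _ (e.bijective _ _) g).symm
  map_swap m n := by rw [Equiv.symm_apply_eq]; exact (e.map_swap m n).symm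
  bijective _ _ := Equiv.bijective _

theorem apply_symm_apply {A B : PROP} (e : PROP.Iso A B) {n m : ℕ} (f : B.Hom n m) :
    e.toFun (e.symm.toFun f) = f :=
  Equiv.ofBijective_apply_symm_apply _ (e.bijective n m) f

theorem symm_apply_apply {A B : PROP} (e : PROP.Iso A B) {n m : ℕ} (f : A.Hom n m) :
    e.symm.toFun (e.toFun f) = f :=
  Equiv.ofBijective_symm_apply_apply _ (e.bijective n m) f

end PROP.Iso

/-! ### Universal property of a composed PROP, and laws obtained from factorizations. -/

namespace DistLaw

open PROP.Mor (copair copair_mk copair_pre copair_post copair_tensor)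

/-- The universal property of the composed PROP: morphisms from its two factors that are
compatible with the distributive law extend to it. -/
def desc {A B C : PROP} (l : DistLaw B A) (i : PROP.Mor A C) (j : PROP.Mor B C)
    (h : ∀ {a b c : ℕ} (g : B.Hom a b) (f : A.Hom b c),
      copair i j (l.toFun (.mk g f)) = C.comp (j.toFun g) (i.toFun f)) :
    PROP.Mor l.prop C where
  toFun := copair i j
  map_id n := by
    change C.comp _ _ = _
    rw [i.map_id, j.map_id, C.comp_id]
  map_comp x y := by
    induction x using Comp.ind with | h f g => ?_
    induction y using Comp.ind with | h f' g' => ?_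
    change copair i j (l.compose (.mk f g) (.mk f' g')) = _
    rw [compose_mk, copair_post, copair_pre, h, copair_mk, copair_mk]
    simp only [C.comp_assoc]
  map_tensor := copair_tensor i j
  map_swap m n := by
    change C.comp _ _ = _
    rw [i.map_swap, j.map_id, C.comp_id]

/-- Reduces statements about arrows of the composed PROP to arrows of its two factors. -/
theorem mk_eq_comp {A B : PROP} (l : DistLaw B A) {n z m : ℕ} (f : A.Hom n z) (g : B.Hom z m) :
    (Comp.mk f g : l.prop.Hom n m) = l.prop.comp (l.inl.toFun f) (l.inr.toFun g) :=
  (Comp.mk_eq_pre f g).trans (l.compose_left f (.mk (A.id z) g)).symm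

theorem inr_comp_inl {A B : PROP} (l : DistLaw B A) {n z m : ℕ} (g : B.Hom n z)
    (f : A.Hom z m) : l.prop.comp (l.inr.toFun g) (l.inl.toFun f) = l.toFun (.mk g f) :=
  (Comp.post_id _).trans (Comp.pre_id _)

theorem copair_inl {A B C : PROP} (l : DistLaw B A) (i : PROP.Mor A C) (j : PROP.Mor B C)
    {n m : ℕ} (f : A.Hom n m) : copair i j (l.inl.toFun f) = i.toFun f :=
  (congrArg (C.comp _) (j.map_id m)).trans (C.comp_id _)

theorem copair_inr {A B C : PROP} (l : DistLaw B A) (i : PROP.Mor A C) (j : PROP.Mor B C)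
    {n m : ℕ} (g : B.Hom n m) : copair i j (l.inr.toFun g) = j.toFun g :=
  (congrArg (C.comp · _) (i.map_id n)).trans (C.id_comp _)

/-- If every arrow of `C` factors as an arrow of `A` followed by an arrow of `B`, uniquely up to
permutation, then reversing composites is a distributive law. -/
def ofFactorization {A B C : PROP} (i : PROP.Mor A C) (j : PROP.Mor B C)
    (e : ∀ {n m}, Comp A B n m ≃ C.Hom n m) (he : ∀ {n m} (x : Comp A B n m), e x = copair i j x) :
    DistLaw B A where
  toFun x := e.symm (copair j i x)
  map_unit := by rw [Equiv.symm_apply_eq, he]; simp only [copair_mk, i.map_id, j.map_id]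
  map_tensor x y := by
    rw [Equiv.symm_apply_eq, he, copair_tensor, copair_tensor, ← he, ← he,
      Equiv.apply_symm_apply, Equiv.apply_symm_apply]
  map_pre p x := by
    rw [Equiv.symm_apply_eq, he, copair_pre, copair_pre, ← he, Equiv.apply_symm_apply,
      i.map_perm, j.map_perm]
  map_post x p := by
    rw [Equiv.symm_apply_eq, he, copair_post, copair_post, ← he, Equiv.apply_symm_apply,
      i.map_perm, j.map_perm]
  unit_right f := by
    rw [Equiv.symm_apply_eq, he]
    simp only [copair_mk, i.map_id, C.comp_id, C.id_comp]
  unit_left f := by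
    rw [Equiv.symm_apply_eq, he]
    simp only [copair_mk, j.map_id, C.comp_id, C.id_comp]
  mul_right x := by
    rw [Equiv.symm_apply_eq, he]
    obtain ⟨_, _, g, f, f'⟩ := x
    change C.comp (j.toFun g) (i.toFun (A.comp f f')) =
      copair i j (Cell.whiskerLeft A _ (Comp₃.ofLeft (e.symm (copair j i (.mk g f))) f')).mulLeft
    -- Rewriting backwards with `apply_symm_apply` also changes the argument of `e.symm` on the
    -- right; the last rewrite undoes this. Both sides then depend on the reordered pair alone, for
    -- which a representative can be chosen.
    rw [i.map_comp, ← C.comp_assoc, ← copair_mk j i, ← e.apply_symm_apply (copair j i (.mk g f)),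
      he, e.symm_apply_eq.mpr (he _).symm]
    generalize e.symm (copair j i (Comp.mk g f)) = u
    induction u using Comp.ind with | h f₁ g₁ => ?_
    change _ = copair i j (Comp₃.ofRight f₁ (e.symm (copair j i (.mk g₁ f')))).mulLeft
    rw [copair_mk, C.comp_assoc, ← copair_mk j i,
      ← e.apply_symm_apply (copair j i (.mk g₁ f')), he, e.symm_apply_eq.mpr (he _).symm]
    generalize e.symm (copair j i (Comp.mk g₁ f')) = v
    induction v using Comp.ind with | h f₂ g₂ => ?_
    exact (copair_pre i j f₁ (.mk f₂ g₂)).symm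
  mul_left x := by
    rw [Equiv.symm_apply_eq, he]
    obtain ⟨_, _, g, g', f⟩ := x
    change C.comp (j.toFun (B.comp g g')) (i.toFun f) =
      copair i j (Cell.whiskerRight _ B
        (Comp₃.ofRight g (e.symm (copair j i (.mk g' f))))).mulRight
    rw [j.map_comp, C.comp_assoc, ← copair_mk j i, ← e.apply_symm_apply (copair j i (.mk g' f)),
      he, e.symm_apply_eq.mpr (he _).symm]
    generalize e.symm (copair j i (Comp.mk g' f)) = u
    induction u using Comp.ind with | h f₁ g₁ => ?_
    change _ = copair i j (Comp₃.ofLeft (e.symm (copair j i (.mk g f₁))) g₁).mulRight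
    rw [copair_mk, ← C.comp_assoc, ← copair_mk j i,
      ← e.apply_symm_apply (copair j i (.mk g f₁)), he, e.symm_apply_eq.mpr (he _).symm]
    generalize e.symm (copair j i (Comp.mk g f₁)) = v
    induction v using Comp.ind with | h f₂ g₂ => ?_
    exact (copair_post i j (.mk f₂ g₂) g₁).symm

/-- True by construction of the law; it is the compatibility that `desc` asks for. -/
theorem copair_ofFactorization {A B C : PROP} (i : PROP.Mor A C) (j : PROP.Mor B C)
    (e : ∀ {n m}, Comp A B n m ≃ C.Hom n m) (he : ∀ {n m} (x : Comp A B n m), e x = copair i j x)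
    {n m : ℕ} (x : Comp B A n m) :
    copair i j ((ofFactorization i j e he).toFun x) = copair j i x :=
  (he _).symm.trans (e.apply_symm_apply _)

/-- The composed PROP of the distributive law given by a factorization is the factored PROP. -/
def ofFactorizationIso {A B C : PROP} (i : PROP.Mor A C) (j : PROP.Mor B C)
    (e : ∀ {n m}, Comp A B n m ≃ C.Hom n m) (he : ∀ {n m} (x : Comp A B n m), e x = copair i j x) :
    PROP.Iso (ofFactorization i j e he).prop C where
  toMor := desc _ i j fun g f => copair_ofFactorization i j e he (.mk g f)
  bijective n m := by
    have h : ⇑(e (n := n) (m := m)) = copair i j := funext he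
    change Function.Bijective (copair i j)
    rw [← h]
    exact e.bijective

/-! ### Rebracketing of composable triples. -/

/-- Rebracketing `A ; (B ; C) → A ; B ; C`, inverse to `assocRight`. -/
def unassocRight {B C : PROP} (A : PROP) (l : DistLaw C B) {n m : ℕ} :
    Comp A l.prop n m → Comp₃ A B C n m :=
  Quot.lift (fun x => Comp₃.ofRight x.fst x.snd) (by
    rintro _ _ ⟨f, p, x⟩
    exact (Comp₃.ofRight_pre f p x).trans (congrArg (Comp₃.ofRight f) (l.perm_comp p x).symm))

/-- Rebracketing `(A ; B) ; C → A ; B ; C`, inverse to `assocLeft`. -/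
def unassocLeft {A B : PROP} (l : DistLaw B A) (C : PROP) {n m : ℕ} :
    Comp l.prop C n m → Comp₃ A B C n m :=
  Quot.lift (fun x => Comp₃.ofLeft x.fst x.snd) (by
    rintro _ _ ⟨x, p, h⟩
    exact (congrArg (Comp₃.ofLeft · h) (l.comp_perm x p)).trans (Comp₃.ofLeft_post x p h))

theorem unassocRight_assocRight {B C : PROP} (A : PROP) (l : DistLaw C B) {n m : ℕ}
    (x : Comp₃ A B C n m) : l.unassocRight A (l.assocRight A x) = x := by
  obtain ⟨_, _, f, g, h⟩ := x; rfl

theorem assocRight_unassocRight {B C : PROP} (A : PROP) (l : DistLaw C B) {n m : ℕ}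
    (x : Comp A l.prop n m) : l.assocRight A (l.unassocRight A x) = x := by
  obtain ⟨_, f, ⟨_, g, h⟩⟩ := x; rfl

theorem unassocLeft_assocLeft {A B : PROP} (l : DistLaw B A) (C : PROP) {n m : ℕ}
    (x : Comp₃ A B C n m) : l.unassocLeft C (l.assocLeft C x) = x := by
  obtain ⟨_, _, f, g, h⟩ := x; rfl

theorem assocLeft_unassocLeft {A B : PROP} (l : DistLaw B A) (C : PROP) {n m : ℕ}
    (x : Comp l.prop C n m) : l.assocLeft C (l.unassocLeft C x) = x := by
  obtain ⟨_, ⟨_, f, g⟩, h⟩ := x; rfl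

/-! ### The composite law of `H` over `F ; G`. -/

section

variable {F G H : PROP} (lam : DistLaw H F) (chi : DistLaw H G) (psi : DistLaw G F)

/-- `(f, [g, h]) ↦ [[f, g], h]`. -/
def bracketLeft {n z m : ℕ} (f : F.Hom n z) (w : Comp G H z m) : Comp psi.prop H n m :=
  psi.assocLeft H (Comp₃.ofRight f w)

/-- `([f, h], g) ↦ [[f, g'], h']`, where the law sends `[h, g]` to `[g', h']`. -/
def bracketCross {n z m : ℕ} (u : Comp F H n z) (g : G.Hom z m) : Comp psi.prop H n m :=
  psi.assocLeft H (chi.toCell.whiskerLeft F (Comp₃.ofLeft u g))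

/-- Governs the computations below: once `lam` has been replaced by a representative `[f, h]`, the
arrow `f` is a spectator and only `chi` acts. -/
theorem bracketCross_mk {n z w m : ℕ} (f : F.Hom n z) (h : H.Hom z w) (g : G.Hom w m) :
    chi.bracketCross psi (.mk f h) g = psi.bracketLeft f (chi.toFun (.mk h g)) := rfl

theorem bracketLeft_comp {n k z m : ℕ} (f : F.Hom n k) (f' : F.Hom k z) (w : Comp G H z m) :
    psi.bracketLeft (F.comp f f') w = (psi.bracketLeft f' w).pre (psi.inl.toFun f) := by
  induction w using Comp.ind with | h g h => ?_
  exact congrArg (Comp.mk (A := psi.prop) · h) (psi.compose_left f (.mk f' g)).symm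

theorem bracketLeft_post {n k z m : ℕ} (f : F.Hom n k) (w : Comp G H k z) (h : H.Hom z m) :
    psi.bracketLeft f (w.post h) = (psi.bracketLeft f w).post h := by
  induction w using Comp.ind with | h g h' => rfl

theorem bracketLeft_pre {n k z m : ℕ} (f : F.Hom n k) (g : G.Hom k z) (w : Comp G H z m) :
    psi.bracketLeft f (w.pre g) =
      (psi.bracketLeft (F.id z) w).pre (A := psi.prop) (.mk f g) := by
  induction w using Comp.ind with | h g' h' => ?_
  refine congrArg (Comp.mk (A := psi.prop) · h') ?_
  exact (psi.compose_right (.mk f g) g').symm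

theorem bracketCross_pre {n k z m : ℕ} (f : F.Hom n k) (u : Comp F H k z) (g : G.Hom z m) :
    chi.bracketCross psi (u.pre f) g = (chi.bracketCross psi u g).pre (psi.inl.toFun f) := by
  induction u using Comp.ind with | h f' h => exact psi.bracketLeft_comp f f' _

/-- Comes from the equivariance of `chi` on the right; it gives the same equivariance for
`crossCell`. -/
theorem bracketCross_comp_perm {n k z : ℕ} (u : Comp F H n k) (g : G.Hom k z)
    {m : ℕ} (p : Perm.Hom z m) : chi.bracketCross psi u (G.comp g (G.perm p)) =
      (chi.bracketCross psi u g).post (H.perm p) := by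
  induction u using Comp.ind with | h f' h => ?_
  rw [bracketCross_mk, bracketCross_mk, ← bracketLeft_post, ← chi.map_post]
  rfl

theorem bracketLeft_tensor {a b c a' b' c' : ℕ} (f : F.Hom a b) (w : Comp G H b c)
    (f' : F.Hom a' b') (w' : Comp G H b' c') :
    psi.bracketLeft (F.tensor f f') (w.tensor w') =
      (psi.bracketLeft f w).tensor (psi.bracketLeft f' w') := by
  induction w using Comp.ind with | h g h => ?_
  induction w' using Comp.ind with | h g' h' => rfl

theorem bracketCross_tensor {a b c a' b' c' : ℕ} (u : Comp F H a b) (g : G.Hom b c)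
    (u' : Comp F H a' b') (g' : G.Hom b' c') :
    chi.bracketCross psi (u.tensor u') (G.tensor g g') =
      (chi.bracketCross psi u g).tensor (chi.bracketCross psi u' g') := by
  induction u using Comp.ind with | h f h => ?_
  induction u' using Comp.ind with | h f' h' => ?_
  rw [Comp.mk_tensor_mk, bracketCross_mk, bracketCross_mk, bracketCross_mk, ← bracketLeft_tensor,
    ← chi.map_tensor, Comp.mk_tensor_mk]

/-- The composite `H ; (F ; G) → F ; H ; G → (F ; G) ; H` of two distributive laws. -/
def cross {n m : ℕ} (x : Comp H psi.prop n m) : Comp psi.prop H n m :=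
  psi.assocLeft H (chi.toCell.whiskerLeft F (lam.toCell.whiskerRight G (psi.unassocRight H x)))

/-- `cross` as a morphism of bimodules. -/
def crossCell : Cell H psi.prop where
  toFun := cross lam chi psi
  map_unit := by
    change chi.bracketCross psi (lam.toFun (.mk (H.id 0) (F.id 0))) (G.id 0) = _
    rw [lam.map_unit, bracketCross_mk, chi.map_unit]
    rfl
  map_tensor x y := by
    obtain ⟨_, h, ⟨_, f, g⟩⟩ := x
    obtain ⟨_, h', ⟨_, f', g'⟩⟩ := y
    change chi.bracketCross psi (lam.toFun ((Comp.mk h f).tensor (.mk h' f'))) (G.tensor g g') = _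
    rw [lam.map_tensor, bracketCross_tensor]
    rfl
  map_pre p x := by
    obtain ⟨_, h, ⟨_, f, g⟩⟩ := x
    change chi.bracketCross psi (lam.toFun ((Comp.mk h f).pre (H.perm p))) g = _
    rw [lam.map_pre, bracketCross_pre, psi.inl.map_perm]
    rfl
  map_post x p := by
    obtain ⟨_, h, y⟩ := x
    -- A permutation acts on an arrow of `F ; G` from the right through its `G`-component only, so
    -- `lam` is not affected.
    refine (congrArg (fun y => cross lam chi psi (.mk (B := psi.prop) h y))
      (psi.comp_perm y p)).trans ?_
    obtain ⟨_, f, g⟩ := y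
    exact chi.bracketCross_comp_perm psi _ g p

/-- `([x, h], y) ↦ [x ; y', h']`, where `cross` sends `[h, y]` to `[y', h']`. -/
def crossAct {n k m : ℕ} (u : Comp psi.prop H n k) (y : psi.prop.Hom k m) : Comp psi.prop H n m :=
  ((crossCell lam chi psi).whiskerLeft psi.prop (Comp₃.ofLeft u y)).mulLeft

/-- `crossAct` plays the role of right multiplication by `[y, id]` in the composed PROP, but it
needs only the cell and so is available before the axioms of a law are known. The left factor `x`
comes out in front. -/
theorem crossAct_mk {n k z m : ℕ} (x : psi.prop.Hom n z) (h : H.Hom z k) (y : psi.prop.Hom k m) :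
    crossAct lam chi psi (.mk x h) y = (cross lam chi psi (.mk h y)).pre x := by
  change ((Comp₃.ofRight x (cross lam chi psi (.mk h y)))).mulLeft = _
  generalize cross lam chi psi (.mk h y) = u
  induction u using Comp.ind with | h x' h' => rfl

theorem crossAct_pre {n l k m : ℕ} (x : psi.prop.Hom n l) (u : Comp psi.prop H l k)
    (y : psi.prop.Hom k m) :
    crossAct lam chi psi (u.pre x) y = (crossAct lam chi psi u y).pre x := by
  induction u using Comp.ind with | h x' h => ?_
  rw [crossAct_mk, Comp.pre_pre, ← crossAct_mk]
  rfl

/-- The `F`-component of `[id, g]` is an identity, so `lam` acts trivially and what is left is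
composition in `G ; H`. -/
theorem crossAct_bracketLeft_inr {n k z m : ℕ} (f : F.Hom n k) (w : Comp G H k z)
    (g : G.Hom z m) : crossAct lam chi psi (psi.bracketLeft f w) (psi.inr.toFun g) =
      psi.bracketLeft f (chi.compose w (.mk g (H.id m))) := by
  induction w using Comp.ind with | h g' h => ?_
  refine (crossAct_mk lam chi psi (.mk f g') h _).trans ?_
  rw [compose_mk, Comp.post_id, bracketLeft_pre]
  congr 1
  change chi.bracketCross psi (lam.toFun (.mk h (F.id _))) g = _
  rw [lam.unit_right, bracketCross_mk]

/-- Appending an arrow of `G` changes only the `G`-component; multiplicativity of `chi` suffices. -/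
theorem cross_comp_inr {n k z m : ℕ} (h : H.Hom n k) (x : psi.prop.Hom k z) (g : G.Hom z m) :
    cross lam chi psi (.mk h (psi.prop.comp x (psi.inr.toFun g))) =
      crossAct lam chi psi (cross lam chi psi (.mk h x)) (psi.inr.toFun g) := by
  refine (congrArg (fun y => cross lam chi psi (.mk (B := psi.prop) h y))
      (psi.compose_right x g)).trans ?_
  obtain ⟨_, f, g'⟩ := x
  change chi.bracketCross psi (lam.toFun (.mk h f)) (G.comp g' g) =
    crossAct lam chi psi (chi.bracketCross psi (lam.toFun (.mk h f)) g') _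
  generalize lam.toFun (.mk h f) = u
  induction u using Comp.ind with | h f' h' => ?_
  rw [bracketCross_mk, bracketCross_mk, crossAct_bracketLeft_inr, ← chi.map_comp_right]

/-- Prepending an arrow of `F` changes only the `F`-component; multiplicativity of `lam` suffices,
and in the first crossing `chi` meets only an identity. -/
theorem cross_inl_comp {n k z m : ℕ} (h : H.Hom n k) (f : F.Hom k z) (x : psi.prop.Hom z m) :
    cross lam chi psi (.mk h (psi.prop.comp (psi.inl.toFun f) x)) =
      crossAct lam chi psi (cross lam chi psi (.mk h (psi.inl.toFun f))) x := by
  refine (congrArg (fun y => cross lam chi psi (.mk (B := psi.prop) h y))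
      (psi.compose_left f x)).trans ?_
  obtain ⟨_, f', g⟩ := x
  change chi.bracketCross psi (lam.toFun (.mk h (F.comp f f'))) g =
    crossAct lam chi psi (chi.bracketCross psi (lam.toFun (.mk h f)) (G.id _)) _
  rw [lam.map_comp_right]
  generalize lam.toFun (.mk h f) = u
  induction u using Comp.ind with | h f₁ h₁ => ?_
  rw [compose_mk, Comp.post_id, bracketCross_pre, bracketCross_mk, chi.unit_right]
  exact (crossAct_mk lam chi psi (.mk f₁ (G.id _)) h₁ (.mk f' g)).symm

/-- The only case in which `F` and `G` stand in the wrong order, and the only direct use of the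
Yang-Baxter equation. -/
theorem cross_inr_comp_inl (hYB : YangBaxter lam chi psi) {n k z m : ℕ} (h : H.Hom n k)
    (g : G.Hom k z) (f : F.Hom z m) :
    cross lam chi psi (.mk h (psi.prop.comp (psi.inr.toFun g) (psi.inl.toFun f))) =
      crossAct lam chi psi (cross lam chi psi (.mk h (psi.inr.toFun g))) (psi.inl.toFun f) := by
  -- The left route of the equation applies `psi` to `[g, f]` first, which is composition in `F ;
  -- G`. The right route moves `h` past `g`, then past `f`, and reorders by `psi` at the end; the
  -- identities inserted by `inl` and `inr` reduce `crossAct` to exactly this.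
  have h₂ := congrArg (psi.assocLeft H) (hYB (.mk h g f))
  refine (congrArg (fun y => cross lam chi psi (.mk (B := psi.prop) h y))
    (psi.inr_comp_inl g f)).trans
    (.trans ?_ (h₂.trans ?_))
  · change _ = psi.assocLeft H (chi.toCell.whiskerLeft F (lam.toCell.whiskerRight G
      (Comp₃.ofRight h (psi.toFun (.mk g f)))))
    generalize psi.toFun (.mk g f) = y
    induction y using Comp.ind with | h f' g' => rfl
  · change psi.assocLeft H (psi.toCell.whiskerRight H (lam.toCell.whiskerLeft G
      (Comp₃.ofLeft (chi.toFun (.mk h g)) f))) =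
        crossAct lam chi psi (chi.bracketCross psi (lam.toFun (.mk h (F.id _))) g) _
    rw [lam.unit_right, bracketCross_mk]
    generalize chi.toFun (.mk h g) = w
    induction w using Comp.ind with | h g' h' => ?_
    refine .trans ?_ (crossAct_mk lam chi psi (.mk (F.id _) g') h' (psi.inl.toFun f)).symm
    change psi.assocLeft H (psi.toCell.whiskerRight H
      (Comp₃.ofRight g' (lam.toFun (.mk h' f)))) =
        (chi.bracketCross psi (lam.toFun (.mk h' f)) (G.id _)).pre (psi.inr.toFun g')
    generalize lam.toFun (.mk h' f) = u
    induction u using Comp.ind with | h f₁ h₁ => ?_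
    rw [bracketCross_mk, chi.unit_right]
    change psi.assocLeft H (Comp₃.ofLeft (psi.toFun (.mk g' f₁)) h₁) =
      Comp.mk (A := psi.prop) (psi.prop.comp (psi.inr.toFun g') (psi.inl.toFun f₁)) h₁
    rw [psi.inr_comp_inl]
    generalize psi.toFun (.mk g' f₁) = y
    induction y using Comp.ind with | h f₂ g₂ => rfl

/-- With `x` split as `f'` followed by `g`, the arrow `f'` is peeled off by `cross_inl_comp`; the
rest is the Yang-Baxter case, applied to the `H`-arrow that has already passed `f'`. -/
theorem cross_comp_inl (hYB : YangBaxter lam chi psi) {n k z m : ℕ} (h : H.Hom n k)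
    (x : psi.prop.Hom k z) (f : F.Hom z m) :
    cross lam chi psi (.mk h (psi.prop.comp x (psi.inl.toFun f))) =
      crossAct lam chi psi (cross lam chi psi (.mk h x)) (psi.inl.toFun f) := by
  obtain ⟨w, f', g⟩ := x
  change cross lam chi psi (.mk h (psi.prop.comp (Comp.mk f' g) _)) =
    crossAct lam chi psi (cross lam chi psi (.mk (B := psi.prop) h (Comp.mk f' g))) _
  rw [mk_eq_comp psi f' g, psi.prop.comp_assoc, cross_inl_comp, cross_inl_comp]
  generalize cross lam chi psi (.mk h (psi.inl.toFun f')) = u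
  induction u using Comp.ind with | h x' h' => ?_
  rw [crossAct_mk, crossAct_mk, crossAct_pre, cross_inr_comp_inl lam chi psi hYB]

theorem cross_comp (hYB : YangBaxter lam chi psi) {n k z m : ℕ} (h : H.Hom n k)
    (x : psi.prop.Hom k z) (y : psi.prop.Hom z m) :
    cross lam chi psi (.mk h (psi.prop.comp x y)) =
      crossAct lam chi psi (cross lam chi psi (.mk h x)) y := by
  obtain ⟨w, f, g⟩ := y
  change cross lam chi psi (.mk h (psi.prop.comp x (Comp.mk f g))) =
    crossAct lam chi psi _ (Comp.mk f g)
  rw [mk_eq_comp psi f g, ← psi.prop.comp_assoc, cross_comp_inr, cross_comp_inl lam chi psi hYB]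
  generalize cross lam chi psi (.mk h x) = u
  induction u using Comp.ind with | h x' h' => ?_
  rw [crossAct_mk, crossAct_mk, crossAct_pre, cross_comp_inr]

/-- Two distributive laws `H ; F → F ; H` and `H ; G → G ; H` compose to one of `H` over `F ; G`
if they satisfy the Yang-Baxter equation. -/
def iterate (hYB : YangBaxter lam chi psi) : DistLaw H psi.prop where
  toCell := crossCell lam chi psi
  unit_right {n m} h := by
    change chi.bracketCross psi (lam.toFun (.mk h (F.id _))) (G.id _) = _
    rw [lam.unit_right, bracketCross_mk, chi.unit_right]
    rfl
  unit_left {n m} x := by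
    obtain ⟨_, f, g⟩ := x
    change chi.bracketCross psi (lam.toFun (.mk (H.id _) f)) g = _
    rw [lam.unit_left, bracketCross_mk, chi.unit_left]
    rfl
  mul_right x := by
    obtain ⟨_, _, h, x, y⟩ := x
    exact cross_comp lam chi psi hYB h x y
  mul_left x := by
    obtain ⟨_, _, h, h', ⟨_, f, g⟩⟩ := x
    change chi.bracketCross psi (lam.toFun (.mk (H.comp h h') f)) g =
      ((crossCell lam chi psi).whiskerRight H (Comp₃.ofRight h
        (chi.bracketCross psi (lam.toFun (.mk h' f)) g))).mulRight
    rw [lam.map_comp_left]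
    generalize lam.toFun (.mk h' f) = u
    induction u using Comp.ind with | h f₁ h₁ => ?_
    rw [compose_mk, Comp.pre_id, bracketCross_mk]
    -- On the right, `lam [h, f₁]` shows up only after `chi [h₁, g]` is split into a pair. The claim
    -- is therefore made for an arbitrary `w` in place of that value, and the representative `[f₂,
    -- h₂]` is tied to `lam` by an equation instead of by generalizing.
    have hw : ∀ {d m} (f₂ : F.Hom _ d) (h₂ : H.Hom d _), lam.toFun (.mk h f₁) = .mk f₂ h₂ →
        ∀ w : Comp G H _ m, ((crossCell lam chi psi).whiskerRight H
          (Comp₃.ofRight h (psi.bracketLeft f₁ w))).mulRight =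
            psi.bracketLeft f₂ (chi.compose (.mk (G.id _) h₂) w) := by
      intro _ _ f₂ h₂ hu w
      induction w using Comp.ind with | h g' h' => ?_
      change (Comp₃.ofLeft (chi.bracketCross psi (lam.toFun (.mk h f₁)) g') h').mulRight = _
      rw [hu, bracketCross_mk, compose_mk, Comp.pre_id, bracketLeft_post]
      generalize psi.bracketLeft f₂ _ = v
      induction v using Comp.ind with | h x k => rfl
    obtain ⟨⟨d, f₂, h₂⟩, hu⟩ := Quot.exists_rep (lam.toFun (.mk h f₁))
    replace hu : lam.toFun (.mk h f₁) = .mk f₂ h₂ := hu.symm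
    rw [hw f₂ h₂ hu, ← chi.map_comp_left, hu]
    rfl

end

/-! ### The three factors inside `(F ; G) ; H`. -/

section

variable {F G H : PROP} (lam : DistLaw H F) (chi : DistLaw H G) (psi : DistLaw G F)
  (hYB : YangBaxter lam chi psi)

/-- The inclusion of `F` in `(F ; G) ; H`. -/
def iterate₁ : PROP.Mor F (iterate lam chi psi hYB).prop :=
  psi.inl.comp (iterate lam chi psi hYB).inl

/-- The inclusion of `G` in `(F ; G) ; H`. -/
def iterate₂ : PROP.Mor G (iterate lam chi psi hYB).prop :=
  psi.inr.comp (iterate lam chi psi hYB).inl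

/-- The inclusion of `H` in `(F ; G) ; H`. -/
def iterate₃ : PROP.Mor H (iterate lam chi psi hYB).prop := (iterate lam chi psi hYB).inr

/-- In the composite, `h` followed by `[f, id]` is reordered by `lam` alone, since `chi` meets only
an identity. This and its two analogues serve twice: to compute the law of `G ; H` over `F`, and to
check the equations of the theory. -/
theorem copair_iterate_lam {n z m : ℕ} (h : H.Hom n z) (f : F.Hom z m) :
    copair (iterate₁ lam chi psi hYB) (iterate₃ lam chi psi hYB) (lam.toFun (.mk h f)) =
      (iterate lam chi psi hYB).prop.comp ((iterate₃ lam chi psi hYB).toFun h)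
        ((iterate₁ lam chi psi hYB).toFun f) := by
  refine .trans ?_ ((iterate lam chi psi hYB).inr_comp_inl h (psi.inl.toFun f)).symm
  change _ = chi.bracketCross psi (lam.toFun (.mk h f)) (G.id _)
  generalize lam.toFun (.mk h f) = u
  induction u using Comp.ind with | h f₁ h₁ => ?_
  rw [bracketCross_mk, chi.unit_right]
  exact ((iterate lam chi psi hYB).mk_eq_comp (psi.inl.toFun f₁) h₁).symm

/-- Here the `F`-component is an identity, so `lam` drops out. -/
theorem copair_iterate_chi {n z m : ℕ} (h : H.Hom n z) (g : G.Hom z m) :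
    copair (iterate₂ lam chi psi hYB) (iterate₃ lam chi psi hYB) (chi.toFun (.mk h g)) =
      (iterate lam chi psi hYB).prop.comp ((iterate₃ lam chi psi hYB).toFun h)
        ((iterate₂ lam chi psi hYB).toFun g) := by
  refine .trans ?_ ((iterate lam chi psi hYB).inr_comp_inl h (psi.inr.toFun g)).symm
  change _ = chi.bracketCross psi (lam.toFun (.mk h (F.id _))) g
  rw [lam.unit_right, bracketCross_mk]
  generalize chi.toFun (.mk h g) = w
  induction w using Comp.ind with | h g₁ h₁ => ?_
  exact ((iterate lam chi psi hYB).mk_eq_comp (psi.inr.toFun g₁) h₁).symm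

/-- The identity already holds in `F ; G` and is transported along the inclusion. -/
theorem copair_iterate_psi {n z m : ℕ} (g : G.Hom n z) (f : F.Hom z m) :
    copair (iterate₁ lam chi psi hYB) (iterate₂ lam chi psi hYB) (psi.toFun (.mk g f)) =
      (iterate lam chi psi hYB).prop.comp ((iterate₂ lam chi psi hYB).toFun g)
        ((iterate₁ lam chi psi hYB).toFun f) := by
  refine .trans ?_ ((iterate lam chi psi hYB).inl.map_comp (psi.inr.toFun g) (psi.inl.toFun f))
  rw [psi.inr_comp_inl]
  generalize psi.toFun (.mk g f) = y
  induction y using Comp.ind with | h f₁ g₁ => ?_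
  refine ((iterate lam chi psi hYB).inl.map_comp (psi.inl.toFun f₁) (psi.inr.toFun g₁)).symm.trans ?_
  rw [← psi.mk_eq_comp]

theorem mk_mk_eq_comp {n z w m : ℕ} (f : F.Hom n z) (g : G.Hom z w) (h : H.Hom w m) :
    (Comp.mk (A := psi.prop) (Comp.mk f g) h : (iterate lam chi psi hYB).prop.Hom n m) =
      (iterate lam chi psi hYB).prop.comp ((iterate lam chi psi hYB).prop.comp
        ((iterate₁ lam chi psi hYB).toFun f) ((iterate₂ lam chi psi hYB).toFun g))
        ((iterate₃ lam chi psi hYB).toFun h) := by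
  refine ((iterate lam chi psi hYB).mk_eq_comp (Comp.mk f g) h).trans ?_
  rw [psi.mk_eq_comp, PROP.Mor.map_comp]
  rfl

/-- The inclusion of `G ; H` in `(F ; G) ; H`. -/
def iterate₂₃ : PROP.Mor chi.prop (iterate lam chi psi hYB).prop :=
  chi.desc (iterate₂ lam chi psi hYB) (iterate₃ lam chi psi hYB) (copair_iterate_chi lam chi psi hYB)

/-! ### The law of `G ; H` over `F`, obtained by rebracketing. -/

/-- Rebracketing `F ; (G ; H) ≃ (F ; G) ; H`. -/
def rebracket {n m : ℕ} : Comp F chi.prop n m ≃ Comp psi.prop H n m where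
  toFun x := psi.assocLeft H (chi.unassocRight F x)
  invFun x := chi.assocRight F (psi.unassocLeft H x)
  left_inv x := (congrArg (chi.assocRight F) (psi.unassocLeft_assocLeft H _)).trans
    (chi.assocRight_unassocRight F x)
  right_inv x := (congrArg (psi.assocLeft H) (chi.unassocRight_assocRight F _)).trans
    (psi.assocLeft_unassocLeft H x)

/-- By associativity, rebracketing is a factorization of the composite PROP through `F` and `G ; H`,
as `ofFactorization` requires. -/
theorem rebracket_eq_copair {n m : ℕ} (x : Comp F chi.prop n m) :
    rebracket chi psi x = copair (iterate₁ lam chi psi hYB) (iterate₂₃ lam chi psi hYB) x := by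
  obtain ⟨_, f, ⟨_, g, h⟩⟩ := x
  exact (mk_mk_eq_comp lam chi psi hYB f g h).trans (PROP.comp_assoc _ _ _ _)

/-- The distributive law of `G ; H` over `F` obtained from three laws that satisfy the Yang-Baxter
equation. -/
def iterateRight : DistLaw chi.prop F :=
  ofFactorization (iterate₁ lam chi psi hYB) (iterate₂₃ lam chi psi hYB) (rebracket chi psi)
    (rebracket_eq_copair lam chi psi hYB)

/-- The law takes `[[g, h], f]` to the factorization of the composite of `g`, `h` and `f` in `(F ;
G) ; H`. Moving `f` leftwards there, past `h` by `lam` and past `g` by `psi`, produces this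
factorization. -/
theorem iterateRight_assocLeft {n m : ℕ} (x : Comp₃ G H F n m) :
    (iterateRight lam chi psi hYB).toFun (chi.assocLeft F x) =
      chi.assocRight F (psi.toCell.whiskerRight H (lam.toCell.whiskerLeft G x)) := by
  refine (rebracket chi psi).symm_apply_eq.mpr ?_
  change _ = psi.assocLeft H (chi.unassocRight F (chi.assocRight F _))
  rw [unassocRight_assocRight]
  obtain ⟨_, _, g, h, f⟩ := x
  change (iterate lam chi psi hYB).prop.comp ((iterate lam chi psi hYB).prop.comp
    ((iterate₂ lam chi psi hYB).toFun g) ((iterate₃ lam chi psi hYB).toFun h))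
    ((iterate₁ lam chi psi hYB).toFun f) =
    psi.assocLeft H (psi.toCell.whiskerRight H (Comp₃.ofRight g (lam.toFun (.mk h f))))
  refine (PROP.comp_assoc _ _ _ _).trans ?_
  rw [← copair_iterate_lam]
  generalize lam.toFun (.mk h f) = u
  induction u using Comp.ind with | h f₁ h₁ => ?_
  change _ = psi.assocLeft H (Comp₃.ofLeft (psi.toFun (.mk g f₁)) h₁)
  rw [copair_mk, ← PROP.comp_assoc, ← copair_iterate_psi]
  generalize psi.toFun (.mk g f₁) = y
  induction y using Comp.ind with | h f₂ g₂ => ?_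
  exact (mk_mk_eq_comp lam chi psi hYB f₂ g₂ h₁).symm

/-- The two ways of composing three distributive laws yield the same PROP. -/
noncomputable def iterateIso :
    PROP.Iso (iterate lam chi psi hYB).prop (iterateRight lam chi psi hYB).prop :=
  (ofFactorizationIso (iterate₁ lam chi psi hYB) (iterate₂₃ lam chi psi hYB) (rebracket chi psi)
    (rebracket_eq_copair lam chi psi hYB)).symm

theorem iterateIso_assocLeft {n m : ℕ} (x : Comp₃ F G H n m) :
    (iterateIso lam chi psi hYB).toFun (psi.assocLeft H x) = chi.assocRight F x := by
  have h : (ofFactorizationIso (iterate₁ lam chi psi hYB) (iterate₂₃ lam chi psi hYB)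
      (rebracket chi psi) (rebracket_eq_copair lam chi psi hYB)).toFun (chi.assocRight F x) =
        psi.assocLeft H x := by
    refine (rebracket_eq_copair lam chi psi hYB (chi.assocRight F x)).symm.trans ?_
    exact congrArg (psi.assocLeft H) (chi.unassocRight_assocRight F x)
  rw [← h]
  exact PROP.Iso.symm_apply_apply _ _

/-! ### Universal property of `(F ; G) ; H`. -/

variable {C : PROP} (i : PROP.Mor F C) (j : PROP.Mor G C) (k : PROP.Mor H C)
    (hlam : ∀ {a b c : ℕ} (h : H.Hom a b) (f : F.Hom b c),
      copair i k (lam.toFun (.mk h f)) = C.comp (k.toFun h) (i.toFun f))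
    (hchi : ∀ {a b c : ℕ} (h : H.Hom a b) (g : G.Hom b c),
      copair j k (chi.toFun (.mk h g)) = C.comp (k.toFun h) (j.toFun g))
    (hpsi : ∀ {a b c : ℕ} (g : G.Hom a b) (f : F.Hom b c),
      copair i j (psi.toFun (.mk g f)) = C.comp (j.toFun g) (i.toFun f))

/-- The universal property of `(F ; G) ; H`. -/
def iterateDesc :
    PROP.Mor (iterate lam chi psi hYB).prop C :=
  (iterate lam chi psi hYB).desc (psi.desc i j hpsi) k (by
    intro a b c h x
    obtain ⟨_, f, g⟩ := x
    change copair _ k (chi.bracketCross psi (lam.toFun (.mk h f)) g) =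
      C.comp (k.toFun h) (C.comp (i.toFun f) (j.toFun g))
    -- The image of `h` is moved past that of `f` by `hlam`, then past that of `g` by `hchi`; `hpsi`
    -- is what makes the morphism on `F ; G` exist.
    rw [← C.comp_assoc, ← hlam]
    generalize lam.toFun (.mk h f) = u
    induction u using Comp.ind with | h f₁ h₁ => ?_
    rw [bracketCross_mk, copair_mk, C.comp_assoc, ← hchi]
    generalize chi.toFun (.mk h₁ g) = w
    induction w using Comp.ind with | h g₁ h₂ => ?_
    exact C.comp_assoc _ _ _)

theorem iterateDesc_iterate₁ {n m : ℕ} (f : F.Hom n m) :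
    (iterateDesc lam chi psi hYB i j k hlam hchi hpsi).toFun
      ((iterate₁ lam chi psi hYB).toFun f) = i.toFun f :=
  (copair_inl (iterate lam chi psi hYB) (psi.desc i j hpsi) k (psi.inl.toFun f)).trans
    (copair_inl psi i j f)

theorem iterateDesc_iterate₂ {n m : ℕ} (g : G.Hom n m) :
    (iterateDesc lam chi psi hYB i j k hlam hchi hpsi).toFun
      ((iterate₂ lam chi psi hYB).toFun g) = j.toFun g :=
  (copair_inl (iterate lam chi psi hYB) (psi.desc i j hpsi) k (psi.inr.toFun g)).trans
    (copair_inr psi i j g)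

theorem iterateDesc_iterate₃ {n m : ℕ} (h : H.Hom n m) :
    (iterateDesc lam chi psi hYB i j k hlam hchi hpsi).toFun
      ((iterate₃ lam chi psi hYB).toFun h) = k.toFun h :=
  copair_inr (iterate lam chi psi hYB) (psi.desc i j hpsi) k h

end

end DistLaw

/-! ### Morphisms out of the PROP generated by a theory. -/

namespace SMT

theorem Mor.arrow_eq_eval {T : SMT} {A : PROP} (φ : PROP.Mor T.prop A) {n m : ℕ}
    (t : T.sig.Term n m) :
    φ.toFun (T.arrow t) = t.eval A (fun o => φ.toFun (T.arrow (.gen o))) := by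
  induction t with
  | gen o => rfl
  | id n => exact φ.map_id n
  | swap m n => exact φ.map_swap m n
  | comp s t hs ht =>
    exact (φ.map_comp (T.arrow s) (T.arrow t)).trans (congrArg₂ A.comp hs ht)
  | tensor s t hs ht =>
    exact (φ.map_tensor (T.arrow s) (T.arrow t)).trans (congrArg₂ A.tensor hs ht)

/-- A morphism of PROPs acts on terms by evaluation, so its values on generators determine it. -/
theorem Mor.ext_gen {T : SMT} {A : PROP} {φ ψ : PROP.Mor T.prop A}
    (h : ∀ {n m} (o : T.sig n m), φ.toFun (T.arrow (.gen o)) = ψ.toFun (T.arrow (.gen o)))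
    {n m : ℕ} (x : T.prop.Hom n m) : φ.toFun x = ψ.toFun x := by
  obtain ⟨t⟩ := x
  refine (Mor.arrow_eq_eval φ t).trans (.trans ?_ (Mor.arrow_eq_eval ψ t).symm)
  simp only [h]

/-- An interpretation of the generators that satisfies the equations extends to the PROP generated
by the theory. -/
def desc (T : SMT) {A : PROP} (i : ∀ {n m}, T.sig n m → A.Hom n m)
    (hi : ∀ {n m} (s t : T.sig.Term n m), T.eqs s t → s.eval A i = t.eval A i) :
    PROP.Mor T.prop A where
  toFun := Quot.lift (fun t => t.eval A i) (fun _ _ h => h.eval_eq hi)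
  map_id _ := rfl
  map_comp := by rintro _ _ _ ⟨f⟩ ⟨g⟩; rfl
  map_tensor := by rintro _ _ _ _ ⟨f⟩ ⟨g⟩; rfl
  map_swap _ _ := rfl

theorem eval_arrow_gen {S : Signature} (T : SMT) (i : ∀ {n m}, S n m → T.sig n m) {n m : ℕ}
    (t : S.Term n m) : t.eval T.prop (fun o => T.arrow (.gen (i o))) = T.arrow (t.map i) := by
  induction t with
  | gen o => rfl
  | id n => rfl
  | swap m n => rfl
  | comp s t hs ht => exact congrArg₂ T.compArrow hs ht
  | tensor s t hs ht => exact congrArg₂ T.tensorArrow hs ht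

/-- Renaming of generators, as a morphism between the PROPs generated by two theories. -/
def rename {T T' : SMT} (i : ∀ {n m}, T.sig n m → T'.sig n m)
    (hi : ∀ {n m} (s t : T.sig.Term n m), T.eqs s t → T'.eqs (s.map i) (t.map i)) :
    PROP.Mor T.prop T'.prop :=
  T.desc (fun o => T'.arrow (.gen (i o))) (fun s t h =>
    (eval_arrow_gen T' i s).trans (.trans (Quot.sound (.ax (hi s t h)))
      (eval_arrow_gen T' i t).symm))

theorem rename_arrow {T T' : SMT} (i : ∀ {n m}, T.sig n m → T'.sig n m)
    (hi : ∀ {n m} (s t : T.sig.Term n m), T.eqs s t → T'.eqs (s.map i) (t.map i)) {n m : ℕ}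
    (t : T.sig.Term n m) : (rename i hi).toFun (T.arrow t) = T'.arrow (t.map i) :=
  eval_arrow_gen T' i t

end SMT

theorem Signature.Term.eval_map {S S' : Signature} (A : PROP) (i : ∀ {n m}, S n m → S' n m)
    (j : ∀ {n m}, S' n m → A.Hom n m) {n m : ℕ} (t : S.Term n m) :
    (t.map i).eval A j = t.eval A (fun o => j (i o)) := by
  induction t with
  | gen o => rfl
  | id n => rfl
  | swap m n => rfl
  | comp s t hs ht => exact congrArg₂ A.comp hs ht
  | tensor s t hs ht => exact congrArg₂ A.tensor hs ht

/-! ### Presented PROPs and the equations of a distributive law. -/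

namespace Presentation

theorem symm_interp {T : SMT} {A : PROP} (P : Presentation T A) {n m : ℕ} (t : T.sig.Term n m) :
    (PROP.Iso.symm P).toFun (P.interp t) = T.arrow t :=
  PROP.Iso.symm_apply_apply P (T.arrow t)

theorem exists_interp {T : SMT} {A : PROP} (P : Presentation T A) {n m : ℕ} (f : A.Hom n m) :
    ∃ t, P.interp t = f := by
  obtain ⟨⟨t⟩, ht⟩ := (P.bijective n m).surjective f
  exact ⟨t, ht⟩

theorem interp_eq {T : SMT} {A : PROP} (P : Presentation T A) {n m : ℕ} {s t : T.sig.Term n m}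
    (h : T.eqs s t) : P.interp s = P.interp t :=
  congrArg P.toFun (Quot.sound (.ax h))

theorem map_interp {T : SMT} {A B : PROP} (P : Presentation T A) (φ : PROP.Mor A B) {n m : ℕ}
    (t : T.sig.Term n m) :
    φ.toFun (P.interp t) = t.eval B (fun o => φ.toFun (P.interp (.gen o))) :=
  SMT.Mor.arrow_eq_eval (P.toMor.comp φ) t

/-- A renaming of generators induces a morphism on presented PROPs. -/
noncomputable def rename {T T' : SMT} {A : PROP} (P : Presentation T A)
    (i : ∀ {n m}, T.sig n m → T'.sig n m)
    (hi : ∀ {n m} (s t : T.sig.Term n m), T.eqs s t → T'.eqs (s.map i) (t.map i)) :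
    PROP.Mor A T'.prop :=
  (PROP.Iso.symm P).toMor.comp (SMT.rename i hi)

theorem rename_interp {T T' : SMT} {A : PROP} (P : Presentation T A)
    (i : ∀ {n m}, T.sig n m → T'.sig n m)
    (hi : ∀ {n m} (s t : T.sig.Term n m), T.eqs s t → T'.eqs (s.map i) (t.map i)) {n m : ℕ}
    (t : T.sig.Term n m) : (P.rename i hi).toFun (P.interp t) = T'.arrow (t.map i) :=
  (congrArg (SMT.rename i hi).toFun (P.symm_interp t)).trans (SMT.rename_arrow i hi t)

open PROP.Mor (copair copair_mk)

/-- Choose terms for `g`, `f` and for a representative of `l [g, f]`. The required identity is then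
one of the equations encoded by `l`, which range over all terms and all representatives. -/
theorem copair_rename {A B : PROP} {TA TB T : SMT} (PA : Presentation TA A)
    (PB : Presentation TB B) (l : DistLaw B A)
    (iA : ∀ {n m}, TA.sig n m → T.sig n m) (iB : ∀ {n m}, TB.sig n m → T.sig n m)
    (hA : ∀ {n m} (s t : TA.sig.Term n m), TA.eqs s t → T.eqs (s.map iA) (t.map iA))
    (hB : ∀ {n m} (s t : TB.sig.Term n m), TB.eqs s t → T.eqs (s.map iB) (t.map iB))
    (hl : ∀ {n m} (s t : T.sig.Term n m), l.Eqs PA PB iA iB s t → T.eqs s t)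
    {a b c : ℕ} (g : B.Hom a b) (f : A.Hom b c) :
    copair (PA.rename iA hA) (PB.rename iB hB) (l.toFun (.mk g f)) =
      T.prop.comp ((PB.rename iB hB).toFun g) ((PA.rename iA hA).toFun f) := by
  obtain ⟨s, rfl⟩ := PB.exists_interp g
  obtain ⟨t, rfl⟩ := PA.exists_interp f
  obtain ⟨⟨_, f', g'⟩, h⟩ := Quot.exists_rep (l.toFun (.mk (PB.interp s) (PA.interp t)))
  obtain ⟨s', rfl⟩ := PB.exists_interp g'
  obtain ⟨t', rfl⟩ := PA.exists_interp f'
  rw [← h]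
  change T.prop.comp _ _ = _
  rw [rename_interp, rename_interp, rename_interp, rename_interp]
  exact (Quot.sound (.ax (hl _ _ (.mk s t t' s' h.symm)))).symm

/-- Soundness, in the direction opposite to `copair_rename`: the equations encoded by `l` hold
wherever the two factors map compatibly with `l`. -/
theorem eval_eq_of_eqs {A B C : PROP} {TA TB : SMT} (PA : Presentation TA A)
    (PB : Presentation TB B) (l : DistLaw B A) (i : PROP.Mor A C) (j : PROP.Mor B C)
    (h : ∀ {a b c : ℕ} (g : B.Hom a b) (f : A.Hom b c),
      copair i j (l.toFun (.mk g f)) = C.comp (j.toFun g) (i.toFun f))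
    {S : Signature} (iA : ∀ {n m}, TA.sig n m → S n m) (iB : ∀ {n m}, TB.sig n m → S n m)
    (v : ∀ {n m}, S n m → C.Hom n m)
    (hA : ∀ {n m} (o : TA.sig n m), v (iA o) = i.toFun (PA.interp (.gen o)))
    (hB : ∀ {n m} (o : TB.sig n m), v (iB o) = j.toFun (PB.interp (.gen o)))
    {n m : ℕ} {s t : S.Term n m} (hst : l.Eqs PA PB iA iB s t) : s.eval C v = t.eval C v := by
  obtain ⟨g, f, f', g', hl⟩ := hst
  have := h (PB.interp g) (PA.interp f)
  rw [hl, copair_mk, map_interp, map_interp, map_interp, map_interp] at this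
  simp only [Signature.Term.eval, Signature.Term.eval_map, hA, hB]
  exact this.symm

theorem eval_eq_of_map {A C : PROP} {T : SMT} (P : Presentation T A) (i : PROP.Mor A C)
    {S : Signature} (iA : ∀ {n m}, T.sig n m → S n m) (v : ∀ {n m}, S n m → C.Hom n m)
    (hA : ∀ {n m} (o : T.sig n m), v (iA o) = i.toFun (P.interp (.gen o)))
    {n m : ℕ} {s t : S.Term n m} (h : Signature.Equations.map iA T.eqs s t) :
    s.eval C v = t.eval C v := by
  obtain ⟨s, t, h⟩ := h
  simp only [Signature.Term.eval_map, hA, ← map_interp, P.interp_eq h]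

/-! ### The presentation of the composite. -/

section

variable {F G H : PROP} {TF TG TH : SMT}
  (PF : Presentation TF F) (PG : Presentation TG G) (PH : Presentation TH H)
  (lam : DistLaw H F) (chi : DistLaw H G) (psi : DistLaw G F)
  (hYB : YangBaxter lam chi psi)

open DistLaw

/-- The interpretation of the generators of the iterated theory in `(F ; G) ; H`. -/
def iterateGen {n m : ℕ} :
    (iteratedTheory PF PG PH lam chi psi).sig n m → (DistLaw.iterate lam chi psi hYB).prop.Hom n m
  | .inl (.inl o) => (iterate₁ lam chi psi hYB).toFun (PF.interp (.gen o))
  | .inl (.inr o) => (iterate₂ lam chi psi hYB).toFun (PG.interp (.gen o))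
  | .inr o => (iterate₃ lam chi psi hYB).toFun (PH.interp (.gen o))

/-- The interpretation of the iterated theory in `(F ; G) ; H`. -/
def iterateMor : PROP.Mor (iteratedTheory PF PG PH lam chi psi).prop
    (iterate lam chi psi hYB).prop :=
  SMT.desc _ (iterateGen PF PG PH lam chi psi hYB) (by
    rintro _ _ s t (h | h | h | h | h | h)
    · exact eval_eq_of_map PF (iterate₁ lam chi psi hYB) Signature.in₁ _ (fun _ => rfl) h
    · exact eval_eq_of_map PG (iterate₂ lam chi psi hYB) Signature.in₂ _ (fun _ => rfl) h
    · exact eval_eq_of_map PH (iterate₃ lam chi psi hYB) Signature.in₃ _ (fun _ => rfl) h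
    · exact eval_eq_of_eqs PF PH lam _ _ (copair_iterate_lam lam chi psi hYB) Signature.in₁
        Signature.in₃ _
        (fun _ => rfl) (fun _ => rfl) h
    · exact eval_eq_of_eqs PG PH chi _ _ (copair_iterate_chi lam chi psi hYB) Signature.in₂
        Signature.in₃ _
        (fun _ => rfl) (fun _ => rfl) h
    · exact eval_eq_of_eqs PF PG psi _ _ (copair_iterate_psi lam chi psi hYB) Signature.in₁
        Signature.in₂ _
        (fun _ => rfl) (fun _ => rfl) h)

theorem iteratedTheory_eqs₁ {n m : ℕ} (s t : TF.sig.Term n m) (h : TF.eqs s t) :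
    (iteratedTheory PF PG PH lam chi psi).eqs (s.map Signature.in₁) (t.map Signature.in₁) :=
  .inl ⟨s, t, h⟩

theorem iteratedTheory_eqs₂ {n m : ℕ} (s t : TG.sig.Term n m) (h : TG.eqs s t) :
    (iteratedTheory PF PG PH lam chi psi).eqs (s.map Signature.in₂) (t.map Signature.in₂) :=
  .inr (.inl ⟨s, t, h⟩)

theorem iteratedTheory_eqs₃ {n m : ℕ} (s t : TH.sig.Term n m) (h : TH.eqs s t) :
    (iteratedTheory PF PG PH lam chi psi).eqs (s.map Signature.in₃) (t.map Signature.in₃) :=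
  .inr (.inr (.inl ⟨s, t, h⟩))

/-- The morphism from `F` to the PROP generated by the iterated theory. -/
noncomputable def theory₁ : PROP.Mor F (iteratedTheory PF PG PH lam chi psi).prop :=
  PF.rename Signature.in₁ (iteratedTheory_eqs₁ PF PG PH lam chi psi)

/-- The morphism from `G` to the PROP generated by the iterated theory. -/
noncomputable def theory₂ : PROP.Mor G (iteratedTheory PF PG PH lam chi psi).prop :=
  PG.rename Signature.in₂ (iteratedTheory_eqs₂ PF PG PH lam chi psi)

/-- The morphism from `H` to the PROP generated by the iterated theory. -/
noncomputable def theory₃ : PROP.Mor H (iteratedTheory PF PG PH lam chi psi).prop :=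
  PH.rename Signature.in₃ (iteratedTheory_eqs₃ PF PG PH lam chi psi)

theorem copair_theory_lam {n z m : ℕ} (h : H.Hom n z) (f : F.Hom z m) :
    copair (theory₁ PF PG PH lam chi psi) (theory₃ PF PG PH lam chi psi)
        (lam.toFun (.mk h f)) =
      (iteratedTheory PF PG PH lam chi psi).prop.comp
        ((theory₃ PF PG PH lam chi psi).toFun h) ((theory₁ PF PG PH lam chi psi).toFun f) :=
  copair_rename (T := iteratedTheory PF PG PH lam chi psi) PF PH lam Signature.in₁
    Signature.in₃ (iteratedTheory_eqs₁ PF PG PH lam chi psi)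
    (iteratedTheory_eqs₃ PF PG PH lam chi psi) (fun _ _ h => .inr (.inr (.inr (.inl h)))) h f

theorem copair_theory_chi {n z m : ℕ} (h : H.Hom n z) (g : G.Hom z m) :
    copair (theory₂ PF PG PH lam chi psi) (theory₃ PF PG PH lam chi psi)
        (chi.toFun (.mk h g)) =
      (iteratedTheory PF PG PH lam chi psi).prop.comp
        ((theory₃ PF PG PH lam chi psi).toFun h) ((theory₂ PF PG PH lam chi psi).toFun g) :=
  copair_rename (T := iteratedTheory PF PG PH lam chi psi) PG PH chi Signature.in₂
    Signature.in₃ (iteratedTheory_eqs₂ PF PG PH lam chi psi)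
    (iteratedTheory_eqs₃ PF PG PH lam chi psi) (fun _ _ h => .inr (.inr (.inr (.inr (.inl h))))) h g

theorem copair_theory_psi {n z m : ℕ} (g : G.Hom n z) (f : F.Hom z m) :
    copair (theory₁ PF PG PH lam chi psi) (theory₂ PF PG PH lam chi psi)
        (psi.toFun (.mk g f)) =
      (iteratedTheory PF PG PH lam chi psi).prop.comp
        ((theory₂ PF PG PH lam chi psi).toFun g) ((theory₁ PF PG PH lam chi psi).toFun f) :=
  copair_rename (T := iteratedTheory PF PG PH lam chi psi) PF PG psi Signature.in₁
    Signature.in₂ (iteratedTheory_eqs₁ PF PG PH lam chi psi)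
    (iteratedTheory_eqs₂ PF PG PH lam chi psi) (fun _ _ h => .inr (.inr (.inr (.inr (.inr h))))) g f

/-- The morphism from `(F ; G) ; H` to the PROP generated by the iterated theory. -/
noncomputable def iterateInv : PROP.Mor (DistLaw.iterate lam chi psi hYB).prop
    (iteratedTheory PF PG PH lam chi psi).prop :=
  iterateDesc lam chi psi hYB (theory₁ PF PG PH lam chi psi) (theory₂ PF PG PH lam chi psi)
    (theory₃ PF PG PH lam chi psi) (copair_theory_lam PF PG PH lam chi psi)
    (copair_theory_chi PF PG PH lam chi psi) (copair_theory_psi PF PG PH lam chi psi)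

/-- After choosing a term for `f`, both sides are its evaluation in the composite. Likewise for `G`
and `H` below. -/
theorem iterateMor_theory₁ {n m : ℕ} (f : F.Hom n m) :
    (iterateMor PF PG PH lam chi psi hYB).toFun ((theory₁ PF PG PH lam chi psi).toFun f) =
      (iterate₁ lam chi psi hYB).toFun f := by
  obtain ⟨t, rfl⟩ := PF.exists_interp f
  refine (congrArg (iterateMor PF PG PH lam chi psi hYB).toFun
    (PF.rename_interp Signature.in₁ (iteratedTheory_eqs₁ PF PG PH lam chi psi) t)).trans ?_
  refine .trans ?_ (PF.map_interp (iterate₁ lam chi psi hYB) t).symm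
  exact Signature.Term.eval_map _ Signature.in₁ (iterateGen PF PG PH lam chi psi hYB) t

theorem iterateMor_theory₂ {n m : ℕ} (g : G.Hom n m) :
    (iterateMor PF PG PH lam chi psi hYB).toFun ((theory₂ PF PG PH lam chi psi).toFun g) =
      (iterate₂ lam chi psi hYB).toFun g := by
  obtain ⟨t, rfl⟩ := PG.exists_interp g
  refine (congrArg (iterateMor PF PG PH lam chi psi hYB).toFun
    (PG.rename_interp Signature.in₂ (iteratedTheory_eqs₂ PF PG PH lam chi psi) t)).trans ?_
  refine .trans ?_ (PG.map_interp (iterate₂ lam chi psi hYB) t).symm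
  exact Signature.Term.eval_map _ Signature.in₂ (iterateGen PF PG PH lam chi psi hYB) t

theorem iterateMor_theory₃ {n m : ℕ} (h : H.Hom n m) :
    (iterateMor PF PG PH lam chi psi hYB).toFun ((theory₃ PF PG PH lam chi psi).toFun h) =
      (iterate₃ lam chi psi hYB).toFun h := by
  obtain ⟨t, rfl⟩ := PH.exists_interp h
  refine (congrArg (iterateMor PF PG PH lam chi psi hYB).toFun
    (PH.rename_interp Signature.in₃ (iteratedTheory_eqs₃ PF PG PH lam chi psi) t)).trans ?_
  refine .trans ?_ (PH.map_interp (iterate₃ lam chi psi hYB) t).symm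
  exact Signature.Term.eval_map _ Signature.in₃ (iterateGen PF PG PH lam chi psi hYB) t

/-- Every arrow of the composite is built from one arrow each of `F`, `G` and `H`, and on these
factors the round trip is known. -/
theorem iterateMor_iterateInv {n m : ℕ} (x : (iterate lam chi psi hYB).prop.Hom n m) :
    (iterateMor PF PG PH lam chi psi hYB).toFun
      ((iterateInv PF PG PH lam chi psi hYB).toFun x) = x := by
  obtain ⟨_, ⟨_, f, g⟩, h⟩ := x
  refine .trans ?_ (mk_mk_eq_comp lam chi psi hYB f g h).symm
  rw [← iterateMor_theory₁ PF PG PH, ← iterateMor_theory₂ PF PG PH,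
    ← iterateMor_theory₃ PF PG PH, ← PROP.Mor.map_comp, ← PROP.Mor.map_comp]
  rfl

/-- It suffices to compare with the identity on generators, where the universal property of the
composite gives the value. -/
theorem iterateInv_iterateMor {n m : ℕ}
    (x : (iteratedTheory PF PG PH lam chi psi).prop.Hom n m) :
    (iterateInv PF PG PH lam chi psi hYB).toFun
      ((iterateMor PF PG PH lam chi psi hYB).toFun x) = x := by
  refine SMT.Mor.ext_gen
    (φ := (iterateMor PF PG PH lam chi psi hYB).comp (iterateInv PF PG PH lam chi psi hYB))
    (ψ := ⟨id, fun _ => rfl, fun _ _ => rfl, fun _ _ => rfl, fun _ _ => rfl⟩) ?_ x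
  rintro n m ((o | o) | o)
  · exact (iterateDesc_iterate₁ lam chi psi hYB _ _ _
      (copair_theory_lam PF PG PH lam chi psi) (copair_theory_chi PF PG PH lam chi psi)
      (copair_theory_psi PF PG PH lam chi psi) _).trans (rename_interp _ _ _ (.gen o))
  · exact (iterateDesc_iterate₂ lam chi psi hYB _ _ _
      (copair_theory_lam PF PG PH lam chi psi) (copair_theory_chi PF PG PH lam chi psi)
      (copair_theory_psi PF PG PH lam chi psi) _).trans (rename_interp _ _ _ (.gen o))
  · exact (iterateDesc_iterate₃ lam chi psi hYB _ _ _
      (copair_theory_lam PF PG PH lam chi psi) (copair_theory_chi PF PG PH lam chi psi)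
      (copair_theory_psi PF PG PH lam chi psi) _).trans (rename_interp _ _ _ (.gen o))

/-- The presentation of `(F ; G) ; H` by the iterated theory. -/
def iterate : Presentation (iteratedTheory PF PG PH lam chi psi) (iterate lam chi psi hYB).prop where
  toMor := iterateMor PF PG PH lam chi psi hYB
  bijective _ _ := Function.bijective_iff_has_inverse.mpr
    ⟨(iterateInv PF PG PH lam chi psi hYB).toFun, iterateInv_iterateMor PF PG PH lam chi psi hYB,
      iterateMor_iterateInv PF PG PH lam chi psi hYB⟩

end

end Presentation

theorem mainTheorem4 {F G H : PROP} {TF TG TH : SMT}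
    (PF : Presentation TF F) (PG : Presentation TG G) (PH : Presentation TH H)
    (lam : DistLaw H F) (chi : DistLaw H G) (psi : DistLaw G F)
    (hYB : YangBaxter lam chi psi) :
    ∃ (α : DistLaw H psi.prop) (β : DistLaw chi.prop F),
      -- `α` is `H ; F ; G → F ; H ; G → F ; G ; H`
      (∀ {n m : ℕ} (x : Comp₃ H F G n m),
        α.toFun (psi.assocRight H x) =
          psi.assocLeft H (chi.toCell.whiskerLeft F (lam.toCell.whiskerRight G x))) ∧
      -- `β` is `G ; H ; F → G ; F ; H → F ; G ; H`
      (∀ {n m : ℕ} (x : Comp₃ G H F n m),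
        β.toFun (chi.assocLeft F x) =
          chi.assocRight F (psi.toCell.whiskerRight H (lam.toCell.whiskerLeft G x))) ∧
      -- `(F ; G) ; H` and `F ; (G ; H)` are the same PROP
      (∃ e : PROP.Iso α.prop β.prop, ∀ {n m : ℕ} (x : Comp₃ F G H n m),
        e.toFun (psi.assocLeft H x) = chi.assocRight F x) ∧
      -- it is presented by the theory, generators being interpreted in `F`, `G` and `H`
      ∃ P : Presentation (iteratedTheory PF PG PH lam chi psi) α.prop,
        (∀ {n m : ℕ} (o : TF.sig n m), P.interp (.gen (Signature.in₁ o)) =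
          α.inl.toFun (psi.inl.toFun (PF.interp (.gen o)))) ∧
        (∀ {n m : ℕ} (o : TG.sig n m), P.interp (.gen (Signature.in₂ o)) =
          α.inl.toFun (psi.inr.toFun (PG.interp (.gen o)))) ∧
        (∀ {n m : ℕ} (o : TH.sig n m), P.interp (.gen (Signature.in₃ o)) =
          α.inr.toFun (PH.interp (.gen o))) :=
  ⟨DistLaw.iterate lam chi psi hYB, DistLaw.iterateRight lam chi psi hYB,
    -- The law is defined through `unassocRight`, which cancels `assocRight`.
    fun x => congrArg (fun y => psi.assocLeft H (chi.toCell.whiskerLeft F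
      (lam.toCell.whiskerRight G y))) (psi.unassocRight_assocRight H x),
    DistLaw.iterateRight_assocLeft lam chi psi hYB,
    ⟨DistLaw.iterateIso lam chi psi hYB, DistLaw.iterateIso_assocLeft lam chi psi hYB⟩,
    -- The presenting morphism evaluates terms, so on generators it is the prescribed interpretation
    -- by definition.
    Presentation.iterate PF PG PH lam chi psi hYB, fun _ => rfl, fun _ => rfl, fun _ => rfl⟩
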